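/- Setting. Let $(X_1,d_1,\nu_1)$ be a complete, path-connected metric space with a Borel measure $\nu_1$, let $X_2$ be a complete, path-connected metric space, and let $\Omega\subsetneq X_1$ be a bounded domain (a nonempty connected open set). Let $q>1$, $C_q\ge 1$, and assume that $\Omega$ is Ahlfors $q$-regular: $$C_q^{-1}r^q\le \nu_1(B(x,r)\cap\Omega)\le C_q r^q\qquad (x\in\Omega,\ 0<r<\operatorname{diam}\Omega).$$ Let $\varphi:[0,\infty)\to[0,\infty)$ be continuous and increasing with $\varphi(0)=0$ and $\varphi(t)\ge t$ for $t>0$, let $c\ge1$, and let $\Omega$ be a $\varphi$-length John domain with center $x_0\in\Omega$ and constant $c$: every $x\in\Omega$ can be joined to $x_0$ by a curve $\gamma:[0,1]\to\Omega$ with $\gamma(0)=x$, $\gamma(1)=x_0$ and $$\ell(\gamma([0,t]))\le\varphi\big(c\,d_1(\gamma(t),X_1\setminus\Omega)\big)\qquad(t\in[0,1]).$$ (In a length space $d_1(\cdot,X_1\setminus\Omega)=d_1(\cdot,\partial\Omega)$ on $\Omega$.) For $\omega\in\partial\Omega$ let $I^{(\varphi,c)}(\omega,x_0)$ be the set of curves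 $\gamma:(0,1]\to\Omega$ with $\gamma(1)=x_0$, $\lim_{t\to0^+}\gamma(t)=\omega$ and $\ell(\gamma((0,t]))\le\varphi(c\,d_1(\gamma(t),X_1\setminus\Omega))$ for all $t\in(0,1]$. For $\sigma\ge1$, a map $f:\Omega\to X_2$ belongs to $\mathcal A_1(\sigma)$ if there are a nonnegative $\alpha\in L^1(\Omega)$ and a constant $C\ge1$ with $$\operatorname{diam} f(B)\le C\Big(\int_{\sigma B}\alpha\,d\nu_1\Big)^{1/q}$$ for every ball $B=B(x,r)$ whose dilate $\sigma B=B(x,\sigma r)$ satisfies $\sigma B\subset\subset\Omega$ (its closure is a compact subset of $\Omega$). It belongs to $\mathcal A_2(\sigma)$ if there are such $\alpha$ and $C$ with $$\operatorname{diam} f(B)\le C\Big(\int_{\sigma B}\alpha\,d\nu_1\Big)^{1/q}\Big(\log\frac1{\operatorname{diam}B}\Big)^{1/q}$$ for every ball $B$ with $\sigma B\subset\subset\Omega$ and $\operatorname{diam}B<1$. A doubling gauge is a continuous increasing function $h:[0,\infty)\to[0,\infty)$ with $h(0)=0$ such that, for some constant $C$, $h(2t)\le C\,h(t)$ for all $t>0$.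 Its Hausdorff measure is $$\mathcal H^h(E)=\lim_{r\to0}\inf\Big\{\sum_{i\in\mathbb N} h(\operatorname{diam}E_i): E\subset\bigcup_iE_i,\ \operatorname{diam}E_i\le r\Big\}.$$ Let $E_f$ be the set of all $\omega\in\partial\Omega$ for which there is a curve $\gamma\in I^{(\varphi,c)}(\omega,x_0)$ such that $f(\gamma(t))$ has no limit in $X_2$ as $t\to0^+$. Theorem 1.3. There is a $\sigma\ge1$, depending only on the data $q,C_q,c,\varphi$, such that in every such setting the following two assertions hold. (1) If $f\in\mathcal A_1(\sigma)$ and $h$ is a doubling gauge with $$\int_0^1\Big[\frac{\varphi(t)}t\Big]^q h(\varphi(t))^{\frac1{q-1}}\,\frac{dt}t<\infty,$$ then $\mathcal H^h(E_f)=0$. (2) If $f\in\mathcal A_2(\sigma)$ and $h$ is a doubling gauge with $$\int_0^1\Big[\frac{\varphi(t)}t\Big]^q h(\varphi(t))^{\frac1{q-1}}\Big[\log\frac1t\Big]^{\frac1{q-1}}\,\frac{dt}t<\infty,$$ then $\mathcal H^h(E_f)=0$. -/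

import Mathlib

open MeasureTheory Metric Set Filter Topology

universe u v

namespace LengthJohn

/-- A bounded proper domain: a bounded, connected, open set that is not the whole space. -/
structure IsBoundedProperDomain {X : Type u} [MetricSpace X] (Ω : Set X) : Prop where
  isOpen : IsOpen Ω
  isConnected : IsConnected Ω
  isBounded : Bornology.IsBounded Ω
  ne_univ : Ω ≠ univ

/-- `Ω` is Ahlfors `q`-regular with constant `Cq`:
`r ^ q / Cq ≤ ν (B(x, r) ∩ Ω) ≤ Cq * r ^ q` for all `x ∈ Ω` and `0 < r < diam Ω`. -/
def IsAhlforsRegular {X : Type u} [MetricSpace X] [MeasurableSpace X] (ν : Measure X)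
    (Ω : Set X) (q Cq : ℝ) : Prop :=
  ∀ x ∈ Ω, ∀ r : ℝ, 0 < r → r < diam Ω →
    ENNReal.ofReal (r ^ q / Cq) ≤ ν (ball x r ∩ Ω) ∧
      ν (ball x r ∩ Ω) ≤ ENNReal.ofReal (Cq * r ^ q)

/-- The functions `φ` of the length John condition: continuous and increasing on `[0, ∞)`,
`φ 0 = 0`, and `t ≤ φ t` for `t > 0`. Only the values on `[0, ∞)` matter. -/
structure IsJohnFunction (φ : ℝ → ℝ) : Prop where
  continuousOn : ContinuousOn φ (Ici 0)
  monotoneOn : MonotoneOn φ (Ici 0)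
  map_zero : φ 0 = 0
  le_map : ∀ t : ℝ, 0 < t → t ≤ φ t

/-- `Ω` is a `φ`-length John domain with center `x₀` and constant `c`: every `x ∈ Ω` is joined to
`x₀` by a curve `γ : [0, 1] → Ω` with `ℓ(γ([0, t])) ≤ φ (c * d(γ t, X \ Ω))` for all `t`.
The distance to the boundary of `Ω` is measured, as for Whitney decompositions, by the distance
to the complement of `Ω`; in a length space this is the distance to the frontier of `Ω`. -/
def IsLengthJohnDomain {X : Type u} [MetricSpace X] (Ω : Set X) (φ : ℝ → ℝ) (c : ℝ)
    (x₀ : X) : Prop :=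
  x₀ ∈ Ω ∧ ∀ x ∈ Ω, ∃ γ : ℝ → X, ContinuousOn γ (Icc 0 1) ∧ MapsTo γ (Icc 0 1) Ω ∧
    γ 0 = x ∧ γ 1 = x₀ ∧
    ∀ t ∈ Icc (0 : ℝ) 1,
      eVariationOn γ (Icc 0 t) ≤ ENNReal.ofReal (φ (c * infDist (γ t) Ωᶜ))

/-- The `φ`-length John curves `γ : (0, 1] → Ω` with constant `c` that connect the boundary point
`ω` to `x₀`: `γ 1 = x₀`, `γ t → ω` as `t → 0+`, and
`ℓ(γ((0, t])) ≤ φ (c * d(γ t, X \ Ω))` for all `t ∈ (0, 1]`. -/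
def boundaryJohnCurves {X : Type u} [MetricSpace X] (Ω : Set X) (φ : ℝ → ℝ) (c : ℝ)
    (ω x₀ : X) : Set (ℝ → X) :=
  {γ | ContinuousOn γ (Ioc 0 1) ∧ MapsTo γ (Ioc 0 1) Ω ∧
    Tendsto γ (𝓝[>] 0) (𝓝 ω) ∧ γ 1 = x₀ ∧
    ∀ t ∈ Ioc (0 : ℝ) 1,
      eVariationOn γ (Ioc 0 t) ≤ ENNReal.ofReal (φ (c * infDist (γ t) Ωᶜ))}

/-- The set `E_f` of the boundary points `ω` of `Ω` for which `f` fails to have a limit along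
some `φ`-length John curve (with constant `c`) from `ω` to `x₀`. -/
def exceptionalSet {X : Type u} {Y : Type v} [MetricSpace X] [MetricSpace Y] (Ω : Set X)
    (φ : ℝ → ℝ) (c : ℝ) (x₀ : X) (f : X → Y) : Set X :=
  {ω | ω ∈ frontier Ω ∧ ∃ γ ∈ boundaryJohnCurves Ω φ c ω x₀,
    ¬ ∃ y : Y, Tendsto (fun t => f (γ t)) (𝓝[>] 0) (𝓝 y)}

/-- `A ⊂⊂ Ω`: the closure of `A` is a compact subset of `Ω`. -/
def CompactlyContained {X : Type u} [MetricSpace X] (A Ω : Set X) : Prop :=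
  IsCompact (closure A) ∧ closure A ⊆ Ω

/-- The class `𝒜₁(σ)` on `Ω`. Only the values of `f` on `Ω` matter. The diameter is the extended
one, so the inequality says in particular that `f(B)` is bounded. -/
def ClassA₁ {X : Type u} {Y : Type v} [MetricSpace X] [MeasurableSpace X] [MetricSpace Y]
    (ν : Measure X) (Ω : Set X) (q σ : ℝ) (f : X → Y) : Prop :=
  ∃ (α : X → ℝ) (C : ℝ), IntegrableOn α Ω ν ∧ (∀ x ∈ Ω, 0 ≤ α x) ∧ 1 ≤ C ∧
    ∀ (x : X) (r : ℝ), 0 < r → CompactlyContained (ball x (σ * r)) Ω →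
      ediam (f '' ball x r) ≤
        ENNReal.ofReal (C * (∫ y in ball x (σ * r), α y ∂ν) ^ (1 / q))

/-- The class `𝒜₂(σ)` on `Ω`. The inequality is required for the balls of diameter less than `1`,
those for which the power of `log (1 / diam B)` has a meaning. -/
def ClassA₂ {X : Type u} {Y : Type v} [MetricSpace X] [MeasurableSpace X] [MetricSpace Y]
    (ν : Measure X) (Ω : Set X) (q σ : ℝ) (f : X → Y) : Prop :=
  ∃ (α : X → ℝ) (C : ℝ), IntegrableOn α Ω ν ∧ (∀ x ∈ Ω, 0 ≤ α x) ∧ 1 ≤ C ∧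
    ∀ (x : X) (r : ℝ), 0 < r → CompactlyContained (ball x (σ * r)) Ω → diam (ball x r) < 1 →
      ediam (f '' ball x r) ≤
        ENNReal.ofReal (C * (∫ y in ball x (σ * r), α y ∂ν) ^ (1 / q) *
          Real.log (1 / diam (ball x r)) ^ (1 / q))

/-- A doubling gauge function: continuous and increasing on `[0, ∞)`, `h 0 = 0`, and
`h (2 * t) ≤ C * h t` for all `t > 0`. Only the values on `[0, ∞)` matter. -/
structure IsDoublingGauge (h : ℝ → ℝ) : Prop where
  continuousOn : ContinuousOn h (Ici 0)
  monotoneOn : MonotoneOn h (Ici 0)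
  map_zero : h 0 = 0
  doubling : ∃ C : ℝ, ∀ t : ℝ, 0 < t → h (2 * t) ≤ C * h t

/-- The generalized Hausdorff measure of gauge `h`: the limit as `r → 0` of the infimum of
`∑ h (diam Eᵢ)` over the countable covers by sets of diameter at most `r`
(see `MeasureTheory.Measure.mkMetric_apply`). -/
noncomputable def hausdorffGauge {X : Type u} [MetricSpace X] [MeasurableSpace X] [BorelSpace X]
    (h : ℝ → ℝ) : Measure X :=
  Measure.mkMetric fun d : ENNReal => ENNReal.ofReal (h d.toReal)

end LengthJohn

namespace LengthJohn

/-! Write d(x) for the distance from x to the complement of Ω. Cover Ω by Whitney balls B(x, δ d(x))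
and give each the mass a(x) = ∫ α over B(x, d(x)/4); bounded overlap makes ∑ a(x) finite
(`IsWhitneySet.summable_integral`). If a John curve from ω meets the Whitney ball of x, then ω lies
in the shadow of x, the ball of radius 2φ(2c d(x)) about x. Hence the Whitney balls of size about r
met by the curve lie in a ball of radius comparable to φ(2cr), and Ahlfors regularity bounds their
number by a multiple of (φ(2cr)/(2cr))^q (`IsWhitneySet.card_le_of_mem_boundaryJohnCurves`).

Chaining along the curve, f has a limit once ∑ (a L)^(1/q) converges over the small Whitney balls
met, with L = 1 or a logarithm (`IsWhitneySet.exists_tendsto_of_summable`). With the weight w =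
h(φ(2c 2^(-k))) at scale k, Hölder bounds this sum by (∑ a/w)^(1/q) (∑ (w L)^(1/(q-1)))^((q-1)/q).
By the count of balls, the last sum is controlled by the dyadic form of the integral condition, so
it is finite.

Thus ω can be exceptional only if ∑ a/w diverges over the shadows that contain ω. As ∑ a is finite,
a weighted Vitali argument (`exists_countable_cover_of_not_summable`) covers all such ω by enlarged
shadows with ∑ w as small as desired, which is what a null set for the gauge h requires. -/

/-! ### Weighted Vitali covers, and chaining. -/

/-- A disjoint Vitali subfamily J always covers after enlargement; only its cost can be too large.
In that case subtract from b, on J, its minimum m over J. Disjointness of J lowers the weighted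
multiplicity by at most m at each point, so the threshold becomes θ - m, and at least one ball drops
out, which drives the induction. -/
theorem exists_finset_cover_of_weights_pos {X : Type*} {ι : Type*} [PseudoMetricSpace X]
    (x : ι → X) (ρ : ι → ℝ) {w : ι → ℝ} (hw : ∀ i, 0 ≤ w i) (s : Finset ι) :
    ∀ (b : ι → ℝ) (θ : ℝ), (∀ i ∈ s, 0 < b i) → 0 < θ →
    ∃ t ⊆ s, (∀ z : X, θ ≤ ∑ i ∈ s, {i | z ∈ closedBall (x i) (ρ i)}.indicator b i →
        ∃ i ∈ t, z ∈ closedBall (x i) (4 * ρ i)) ∧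
      θ * ∑ i ∈ t, w i ≤ ∑ i ∈ s, b i * w i := by
  classical
  induction s using Finset.strongInduction with
  | H s ih =>
  intro b θ hb hθ
  obtain ⟨R, hR⟩ : ∃ R, ∀ i ∈ (s : Set ι), ρ i ≤ R := by
    obtain ⟨R, hR⟩ := (s.finite_toSet.image ρ).bddAbove
    exact ⟨R, fun i hi => hR ⟨i, hi, rfl⟩⟩
  obtain ⟨J', hJs, hdisj, hcov⟩ :=
    Vitali.exists_disjoint_subfamily_covering_enlargement_closedBall (s : Set ι) x ρ R hR 4
      (by norm_num)
  obtain ⟨J, rfl⟩ : ∃ J : Finset ι, (J : Set ι) = J' :=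
    ⟨_, (s.finite_toSet.subset hJs).coe_toFinset⟩
  have hJs' : J ⊆ s := by exact_mod_cast hJs
  have hJcov : ∀ z : X, θ ≤ ∑ i ∈ s, {i | z ∈ closedBall (x i) (ρ i)}.indicator b i →
      ∃ i ∈ J, z ∈ closedBall (x i) (4 * ρ i) := by
    intro z hz
    obtain ⟨i, his, hi⟩ := Finset.exists_ne_zero_of_sum_ne_zero (hθ.trans_le hz).ne'
    have hzi : z ∈ closedBall (x i) (ρ i) := by
      by_contra h
      exact hi (indicator_of_notMem (by exact h) _)
    obtain ⟨j, hj, hsub⟩ := hcov i his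
    exact ⟨j, hj, hsub hzi⟩
  by_cases hgood : θ * ∑ i ∈ J, w i ≤ ∑ i ∈ s, b i * w i
  · exact ⟨J, hJs', hJcov, hgood⟩
  push Not at hgood
  have hJne : J.Nonempty := by
    rw [Finset.nonempty_iff_ne_empty]
    rintro rfl
    have := Finset.sum_nonneg fun i hi => mul_nonneg (hb i hi).le (hw i)
    simp at hgood
    linarith
  obtain ⟨j₀, hj₀, hmin⟩ := J.exists_min_image b hJne
  set m := b j₀ with hm
  have hmpos : 0 < m := hb _ (hJs' hj₀)
  have hJb : m * ∑ i ∈ J, w i ≤ ∑ i ∈ s, b i * w i := by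
    rw [Finset.mul_sum]
    calc _ ≤ ∑ i ∈ J, b i * w i :=
          Finset.sum_le_sum fun i hi => mul_le_mul_of_nonneg_right (hmin i hi) (hw i)
      _ ≤ _ := Finset.sum_le_sum_of_subset_of_nonneg hJs' fun i hi _ =>
          mul_nonneg (hb i hi).le (hw i)
  have hWJ : 0 ≤ ∑ i ∈ J, w i := Finset.sum_nonneg fun i _ => hw i
  have hmθ : m < θ := by
    by_contra h
    push Not at h
    nlinarith [mul_le_mul_of_nonneg_right h hWJ]
  set b' : ι → ℝ := fun i => b i - if i ∈ J then m else 0 with hb'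
  have hb'0 : ∀ i ∈ s, 0 ≤ b' i := by
    intro i hi
    by_cases hiJ : i ∈ J
    · simpa [hb', hiJ] using hmin i hiJ
    · simpa [hb', hiJ] using (hb i hi).le
  set s' := s.filter fun i => 0 < b' i with hs'
  have hss : s' ⊂ s := by
    refine Finset.filter_ssubset.2 ⟨j₀, hJs' hj₀, ?_⟩
    simp [hb', hj₀, hm]
  have hsum' : ∀ g : ι → ℝ → ℝ, (∀ i, g i 0 = 0) → ∑ i ∈ s', g i (b' i) = ∑ i ∈ s, g i (b' i) := by
    intro g hg
    refine Finset.sum_subset (Finset.filter_subset _ _) fun i hi hi' => ?_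
    have : b' i = 0 := le_antisymm (by simpa [hs', hi] using hi') (hb'0 i hi)
    rw [this, hg]
  have hite : ∀ g : ι → ℝ, ∑ i ∈ J, g i = ∑ i ∈ s, if i ∈ J then g i else 0 := by
    intro g
    rw [Finset.sum_ite_mem, Finset.inter_eq_right.2 hJs']
  obtain ⟨t, hts, ht1, ht2⟩ := ih s' hss b' (θ - m) (fun i hi => (Finset.mem_filter.1 hi).2) (by linarith)
  refine ⟨t, hts.trans hss.1, fun z hz => ht1 z ?_, ?_⟩
  · have h1 : ∑ i ∈ s', {i | z ∈ closedBall (x i) (ρ i)}.indicator b' i =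
        ∑ i ∈ s, {i | z ∈ closedBall (x i) (ρ i)}.indicator b' i := by
      have := hsum' (fun i r => {i | z ∈ closedBall (x i) (ρ i)}.indicator (fun _ => r) i)
        (by intro i; simp)
      simpa [indicator_apply] using this
    have h2 : ∑ i ∈ J, {i | z ∈ closedBall (x i) (ρ i)}.indicator (fun _ => m) i ≤ m := by
      by_cases hz' : ∃ j ∈ J, z ∈ closedBall (x j) (ρ j)
      · obtain ⟨j, hj, hzj⟩ := hz'
        rw [Finset.sum_eq_single_of_mem j hj, indicator_of_mem (by exact hzj)]
        intro k hk hkj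
        refine indicator_of_notMem ?_ _
        intro hzk
        exact (Set.disjoint_left.1 (hdisj hk hj hkj)) hzk hzj
      · push Not at hz'
        rw [Finset.sum_eq_zero]
        · exact hmpos.le
        · intro i hi
          exact indicator_of_notMem (by exact hz' i hi) _
    have h3 : ∑ i ∈ s, {i | z ∈ closedBall (x i) (ρ i)}.indicator b' i =
        ∑ i ∈ s, {i | z ∈ closedBall (x i) (ρ i)}.indicator b i -
        ∑ i ∈ J, {i | z ∈ closedBall (x i) (ρ i)}.indicator (fun _ => m) i := by
      rw [hite, ← Finset.sum_sub_distrib]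
      refine Finset.sum_congr rfl fun i _ => ?_
      by_cases hzi : z ∈ closedBall (x i) (ρ i) <;> by_cases hi : i ∈ J <;>
        simp only [indicator_apply, mem_ofPred_eq, hzi, hi, hb', if_true, if_false, sub_zero]
    rw [h1, h3]
    linarith
  · have h1 : ∑ i ∈ s', b' i * w i = ∑ i ∈ s, b i * w i - m * ∑ i ∈ J, w i := by
      rw [hsum' (fun i r => r * w i) (by simp), Finset.mul_sum, hite,
        ← Finset.sum_sub_distrib]
      refine Finset.sum_congr rfl fun i _ => ?_
      by_cases hi : i ∈ J <;> simp [hb', hi, sub_mul]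
    rw [h1] at ht2
    set W := ∑ i ∈ t, w i
    set V := ∑ i ∈ J, w i
    set S := ∑ i ∈ s, b i * w i
    -- Multiply (θ - m) W ≤ S - m V by θ; the failure of J, that is S < θ V, gives m θ V ≥ m S.
    have h4 : (θ - m) * (θ * W) ≤ (θ - m) * S := by
      nlinarith
    exact le_of_mul_le_mul_left h4 (by linarith)

/-- A finite weighted cover by balls contains, after enlargement of the balls, an honest cover of
no larger cost. -/
theorem exists_finset_cover_of_weights {X : Type*} {ι : Type*} [PseudoMetricSpace X]
    (x : ι → X) (ρ : ι → ℝ) {w b : ι → ℝ} (hw : ∀ i, 0 ≤ w i) (hb : ∀ i, 0 ≤ b i)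
    (s : Finset ι) {θ : ℝ} (hθ : 0 < θ) :
    ∃ t ⊆ s, (∀ z : X, θ ≤ ∑ i ∈ s, {i | z ∈ closedBall (x i) (ρ i)}.indicator b i →
        ∃ i ∈ t, z ∈ closedBall (x i) (4 * ρ i)) ∧
      θ * ∑ i ∈ t, w i ≤ ∑ i ∈ s, b i * w i := by
  classical
  obtain ⟨t, hts, h1, h2⟩ :=
    exists_finset_cover_of_weights_pos x ρ hw (s.filter fun i => 0 < b i) b θ
      (fun i hi => (Finset.mem_filter.1 hi).2) hθ
  have key : ∀ i ∈ s, i ∉ s.filter (fun i => 0 < b i) → b i = 0 := fun i hi hi' =>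
    le_antisymm (by simpa [hi] using hi') (hb i)
  refine ⟨t, hts.trans (Finset.filter_subset _ _), fun z hz => h1 z ?_, ?_⟩
  · rwa [Finset.sum_subset (Finset.filter_subset _ _)]
    intro i hi hi'
    simp [indicator_apply, key i hi hi']
  · rwa [Finset.sum_subset (Finset.filter_subset _ s)
      (f := fun i => b i * w i)] at h2
    intro i hi hi'
    simp [key i hi hi']

/-- If `∑ a i < ∞`, the points that lie in so many of the balls `B i` that `∑ a i / w i = ∞` over
these balls can be covered by enlarged balls of arbitrarily small total cost `∑ w i`. -/
theorem exists_countable_cover_of_not_summable {X : Type*} {ι : Type*} [PseudoMetricSpace X]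
    (x : ι → X) (ρ : ι → ℝ) {w a : ι → ℝ} (hw : ∀ i, 0 < w i) (ha : ∀ i, 0 ≤ a i)
    (hsum : Summable a) {ε : ℝ} (hε : 0 < ε) :
    ∃ J : Set ι, J.Countable ∧
      (∀ z : X, ¬ Summable ({i | z ∈ closedBall (x i) (ρ i)}.indicator fun i => a i / w i) →
        ∃ i ∈ J, z ∈ closedBall (x i) (4 * ρ i)) ∧
      ∑' i : J, ENNReal.ofReal (w i) ≤ ENNReal.ofReal ε := by
  classical
  have hG : ∀ j : ℕ, ∃ G : Finset ι, ∀ T : Finset ι, Disjoint T G →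
      ∑ i ∈ T, a i < ε / 2 * (1 / 4) ^ j := by
    intro j
    obtain ⟨G, hG⟩ := summable_iff_vanishing_norm.1 hsum (ε / 2 * (1 / 4) ^ j) (by positivity)
    exact ⟨G, fun T hT => (le_abs_self _).trans_lt (hG T hT)⟩
  choose G hG using hG
  set H : ℕ → Finset ι := fun n => (Finset.range (n + 1)).biUnion G with hH
  have hHmono : Monotone H := by
    intro m n hmn
    exact Finset.biUnion_subset_biUnion_of_subset_left _ (by simpa using hmn)
  have hGH : ∀ n, G n ⊆ H n := fun n =>
    Finset.subset_biUnion_of_mem G (by simp)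
  have hblock : ∀ j : ℕ, ∑ i ∈ H (j + 1) \ H j, a i ≤ ε / 2 * (1 / 4) ^ j := fun j =>
    (hG j _ ((Finset.sdiff_disjoint).mono_right (hGH j))).le
  -- Threshold 2^(-j) against block mass (ε/2) 4^(-j): both the cost (ε/2) 2^(-j) and the block sum
  -- 2^(-j) left at an uncovered point are geometric.
  have hcov : ∀ j : ℕ, ∃ t : Finset ι,
      (∀ z : X, (1 / 2 : ℝ) ^ j ≤ ∑ i ∈ H (j + 1) \ H j,
          {i | z ∈ closedBall (x i) (ρ i)}.indicator (fun i => a i / w i) i →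
        ∃ i ∈ t, z ∈ closedBall (x i) (4 * ρ i)) ∧
      ∑ i ∈ t, w i ≤ ε / 2 * (1 / 2) ^ j := by
    intro j
    obtain ⟨t, -, h1, h2⟩ := exists_finset_cover_of_weights x ρ (w := w) (b := fun i => a i / w i)
      (fun i => (hw i).le) (fun i => div_nonneg (ha i) (hw i).le) (H (j + 1) \ H j)
      (θ := (1 / 2) ^ j) (by positivity)
    refine ⟨t, h1, ?_⟩
    have h3 : ∑ i ∈ H (j + 1) \ H j, a i / w i * w i = ∑ i ∈ H (j + 1) \ H j, a i :=
      Finset.sum_congr rfl fun i _ => div_mul_cancel₀ _ (hw i).ne'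
    have h4 : ((1 : ℝ) / 4) ^ j = (1 / 2) ^ j * (1 / 2) ^ j := by
      rw [← mul_pow]; norm_num
    have h5 := (h2.trans h3.le).trans (hblock j)
    rw [h4] at h5
    have h6 : (0 : ℝ) < (1 / 2) ^ j := by positivity
    exact le_of_mul_le_mul_left (by linarith) h6
  choose t ht1 ht2 using hcov
  refine ⟨⋃ j, (t j : Set ι), countable_iUnion fun j => (t j).countable_toSet, ?_, ?_⟩
  · intro z hz
    by_contra hcon
    have hlt : ∀ j : ℕ, ∑ i ∈ H (j + 1) \ H j,
        {i | z ∈ closedBall (x i) (ρ i)}.indicator (fun i => a i / w i) i < (1 / 2 : ℝ) ^ j := by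
      intro j
      by_contra h
      push Not at h
      obtain ⟨i, hi, hzi⟩ := ht1 j z h
      exact hcon ⟨i, mem_iUnion.2 ⟨j, hi⟩, hzi⟩
    set g := {i | z ∈ closedBall (x i) (ρ i)}.indicator (fun i => a i / w i) with hg
    have hg0 : ∀ i, 0 ≤ g i := fun i =>
      indicator_nonneg (fun i _ => div_nonneg (ha i) (hw i).le) i
    have hsumH : ∀ n, ∑ i ∈ H n, g i ≤ ∑ i ∈ H 0, g i + (2 - 2 * (1 / 2) ^ n) := by
      intro n
      induction n with
      | zero => simp
      | succ n ih =>
        rw [← Finset.sum_sdiff (hHmono n.le_succ), pow_succ]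
        linarith [hlt n]
    refine hz (summable_of_sum_le hg0 (c := ∑ i ∈ H 0, g i + 2) fun F => ?_)
    -- The blocks exhaust every index of positive mass: a singleton outside `G n` has mass below
    -- (ε/2) 4^(-n).
    have hmem : ∀ i ∈ F.filter (fun i => a i ≠ 0), ∃ n, i ∈ H n := by
      intro i hi
      have hai : 0 < a i := lt_of_le_of_ne (ha i) (Ne.symm (Finset.mem_filter.1 hi).2)
      obtain ⟨n, hn⟩ := exists_pow_lt_of_lt_one (show 0 < a i / (ε / 2) by positivity)
        (show (1 / 4 : ℝ) < 1 by norm_num)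
      refine ⟨n, hGH n ?_⟩
      by_contra hin
      have := hG n {i} (by simpa using hin)
      rw [lt_div_iff₀ (by positivity)] at hn
      simp only [Finset.sum_singleton] at this
      linarith
    choose! N hN using hmem
    have hsub : F.filter (fun i => a i ≠ 0) ⊆ H ((F.filter (fun i => a i ≠ 0)).sup N) :=
      fun i hi => hHmono (Finset.le_sup hi) (hN i hi)
    have h1 : ∑ i ∈ F, g i = ∑ i ∈ F.filter (fun i => a i ≠ 0), g i := by
      refine (Finset.sum_subset (Finset.filter_subset _ _) fun i hi hi' => ?_).symm
      have : a i = 0 := by simpa [hi] using hi'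
      simp [hg, indicator_apply, this]
    rw [h1]
    refine (Finset.sum_le_sum_of_subset_of_nonneg hsub fun i _ _ => hg0 i).trans
      ((hsumH _).trans ?_)
    have : (0 : ℝ) < (1 / 2) ^ ((F.filter (fun i => a i ≠ 0)).sup N) := by positivity
    linarith
  · refine (ENNReal.tsum_iUnion_le_tsum (fun i => ENNReal.ofReal (w i)) _).trans ?_
    have h1 : ∀ j, ∑' i : (t j : Set ι), ENNReal.ofReal (w i) ≤
        ENNReal.ofReal (ε / 2 * (1 / 2) ^ j) := by
      intro j
      rw [Finset.tsum_subtype' (t j) (fun i => ENNReal.ofReal (w i)),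
        ← ENNReal.ofReal_sum_of_nonneg fun i _ => (hw i).le]
      exact ENNReal.ofReal_le_ofReal (ht2 j)
    refine (ENNReal.tsum_le_tsum h1).trans ?_
    rw [← ENNReal.ofReal_tsum_of_nonneg (fun j => by positivity)
      (summable_geometric_two.mul_left _), tsum_mul_left, tsum_geometric_two]
    exact ENNReal.ofReal_le_ofReal (by linarith)

/-- Chaining along a finite open cover of a connected set. -/
theorem edist_le_sum_ediam_of_isPreconnected {X : Type*} {Y : Type*} {ι : Type*}
    [TopologicalSpace X] [PseudoEMetricSpace Y] {f : X → Y} {A : Set X} (hA : IsPreconnected A)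
    {U : ι → Set X} (hU : ∀ i, IsOpen (U i)) (F : Finset ι)
    (hcov : A ⊆ ⋃ i ∈ F, U i) {x y : X} (hx : x ∈ A) (hy : y ∈ A) :
    edist (f x) (f y) ≤ ∑ i ∈ F, ediam (f '' U i) := by
  classical
  -- A good subfamily of maximal size must reach y. Otherwise connectedness of A gives a point
  -- shared by a member of G and a member outside G, and the latter can be adjoined. No continuity
  -- of f is involved.
  set good : Finset ι → Prop := fun G => (∃ i ∈ G, x ∈ U i) ∧
    ∀ i ∈ G, ∀ z ∈ U i, edist (f x) (f z) ≤ ∑ i ∈ G, ediam (f '' U i) with hgood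
  have hed : ∀ (i : ι) (z z' : X), z ∈ U i → z' ∈ U i →
      edist (f z) (f z') ≤ ediam (f '' U i) := fun i z z' hz hz' =>
    edist_le_ediam_of_mem (mem_image_of_mem f hz) (mem_image_of_mem f hz')
  have hex : ∃ G ∈ F.powerset.filter good, ∀ G' ∈ F.powerset.filter good, G'.card ≤ G.card := by
    refine Finset.exists_max_image _ _ ?_
    obtain ⟨i, hi, hxi⟩ := mem_iUnion₂.1 (hcov hx)
    refine ⟨{i}, ?_⟩
    simp only [Finset.mem_filter, Finset.mem_powerset, Finset.singleton_subset_iff, hgood]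
    exact ⟨hi, ⟨i, by simp, hxi⟩, by simpa using fun z hz => hed i x z hxi hz⟩
  obtain ⟨G, hG, hmax⟩ := hex
  obtain ⟨hGF, ⟨i₀, hi₀, hxi₀⟩, hGz⟩ := by
    simpa only [Finset.mem_filter, Finset.mem_powerset, hgood] using hG
  by_cases hyG : ∃ i ∈ G, y ∈ U i
  · obtain ⟨i, hi, hyi⟩ := hyG
    exact (hGz i hi y hyi).trans (Finset.sum_le_sum_of_subset hGF)
  exfalso
  have hy' : y ∈ ⋃ i ∈ F \ G, U i := by
    obtain ⟨i, hi, hyi⟩ := mem_iUnion₂.1 (hcov hy)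
    exact mem_iUnion₂.2 ⟨i, Finset.mem_sdiff.2 ⟨hi, fun h => hyG ⟨i, h, hyi⟩⟩, hyi⟩
  obtain ⟨z, hzA, hz1, hz2⟩ := hA (⋃ i ∈ G, U i) (⋃ i ∈ F \ G, U i)
    (isOpen_biUnion fun i _ => hU i) (isOpen_biUnion fun i _ => hU i)
    (by
      intro z hz
      obtain ⟨i, hi, hzi⟩ := mem_iUnion₂.1 (hcov hz)
      by_cases hiG : i ∈ G
      · exact Or.inl (mem_iUnion₂.2 ⟨i, hiG, hzi⟩)
      · exact Or.inr (mem_iUnion₂.2 ⟨i, Finset.mem_sdiff.2 ⟨hi, hiG⟩, hzi⟩))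
    ⟨x, hx, mem_iUnion₂.2 ⟨i₀, hi₀, hxi₀⟩⟩ ⟨y, hy, hy'⟩
  obtain ⟨i, hi, hzi⟩ := mem_iUnion₂.1 hz1
  obtain ⟨j, hj, hzj⟩ := mem_iUnion₂.1 hz2
  obtain ⟨hjF, hjG⟩ := Finset.mem_sdiff.1 hj
  have hins : insert j G ∈ F.powerset.filter good := by
    simp only [Finset.mem_filter, Finset.mem_powerset, hgood, Finset.sum_insert hjG]
    refine ⟨Finset.insert_subset hjF hGF, ⟨i₀, Finset.mem_insert_of_mem hi₀, hxi₀⟩, ?_⟩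
    intro k hk z' hz'
    rcases Finset.mem_insert.1 hk with rfl | hk
    · rw [add_comm]
      exact (edist_triangle _ (f z) _).trans (add_le_add (hGz i hi z hzi) (hed k z z' hzj hz'))
    · exact (hGz k hk z' hz').trans le_add_self
  have := hmax _ hins
  rw [Finset.card_insert_of_notMem hjG] at this
  omega

/-! ### Volume counting and Whitney covers. -/

section Geometry

variable {X : Type*} [MetricSpace X] {Ω : Set X}

/-- Connectedness of the space makes the distance from y take all intermediate values. This gives
lower bounds for diameters: Whitney radii stay in the range of Ahlfors regularity, and balls are not
degenerate. -/
theorem exists_dist_eq_of_lt_infDist_compl [PreconnectedSpace X] (hne : Ωᶜ.Nonempty) (y : X)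
    {s : ℝ} (hs : 0 ≤ s) (hsy : s < infDist y Ωᶜ) : ∃ z ∈ Ω, dist y z = s := by
  obtain ⟨p, hp⟩ := hne
  have := isPreconnected_univ.intermediate_value (mem_univ y) (mem_univ p)
    (f := fun z => dist y z) (by fun_prop)
  obtain ⟨z, -, hz⟩ := this ⟨by simpa using hs, hsy.le.trans (infDist_le_dist_of_mem hp)⟩
  refine ⟨z, ball_infDist_compl_subset (x := y) ?_, hz⟩
  rw [mem_ball, dist_comm]
  exact hz.trans_lt hsy

theorem infDist_compl_le_diam [PreconnectedSpace X] (hΩ : IsBoundedProperDomain Ω) {y : X}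
    (hy : y ∈ Ω) : infDist y Ωᶜ ≤ diam Ω := by
  refine le_of_forall_lt_imp_le_of_dense fun s hs => ?_
  rcases lt_or_ge s 0 with h | h
  · exact h.le.trans diam_nonneg
  obtain ⟨z, hz, rfl⟩ :=
    exists_dist_eq_of_lt_infDist_compl (nonempty_compl.2 hΩ.ne_univ) y h hs
  exact dist_le_diam_of_mem hΩ.isBounded hy hz

theorem le_diam_ball_of_le_infDist_compl [PreconnectedSpace X] (hne : Ωᶜ.Nonempty) {y : X} {r : ℝ}
    (hr : 0 < r) (hry : r ≤ infDist y Ωᶜ) : r ≤ diam (ball y r) := by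
  refine le_of_forall_lt_imp_le_of_dense fun s hs => ?_
  rcases lt_or_ge s 0 with h | h
  · exact h.le.trans diam_nonneg
  obtain ⟨z, -, rfl⟩ := exists_dist_eq_of_lt_infDist_compl hne y h (hs.trans_le hry)
  exact dist_le_diam_of_mem isBounded_ball (mem_ball_self hr) (by rwa [mem_ball, dist_comm])

theorem infDist_compl_pos (hΩ : IsBoundedProperDomain Ω) {y : X} (hy : y ∈ Ω) :
    0 < infDist y Ωᶜ :=
  (hΩ.isOpen.isClosed_compl.notMem_iff_infDist_pos (nonempty_compl.2 hΩ.ne_univ)).1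
    (by simpa using hy)

/-- The volume bound for the number of points of a separated subset of a ball. -/
theorem card_le_of_separated [MeasurableSpace X] [BorelSpace X] {ν : Measure X} {q Cq : ℝ}
    (hCq : 1 ≤ Cq) (hΩ : IsBoundedProperDomain Ω) (hν : IsAhlforsRegular ν Ω q Cq) {x : X}
    (hx : x ∈ Ω) {R s : ℝ} (hs : 0 < s) (hR : 0 ≤ R) (hRs : R + s / 2 < diam Ω) {T : Finset X}
    (hT : ∀ y ∈ T, y ∈ Ω ∧ dist y x ≤ R)
    (hsep : ∀ y ∈ T, ∀ z ∈ T, y ≠ z → s ≤ dist y z) :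
    (T.card : ℝ) ≤ Cq ^ 2 * ((R + s / 2) / (s / 2)) ^ q := by
  have hs2 : 0 < s / 2 := by positivity
  have hCq0 : 0 < Cq := by linarith
  have hlow : ∀ y ∈ T, ENNReal.ofReal ((s / 2) ^ q / Cq) ≤ ν (ball y (s / 2) ∩ Ω) :=
    fun y hy => (hν y (hT y hy).1 _ hs2 (by linarith)).1
  have hup := (hν x hx (R + s / 2) (by positivity) hRs).2
  have hdisj : (T : Set X).PairwiseDisjoint fun y => ball y (s / 2) ∩ Ω := by
    intro y hy z hz hyz
    refine (ball_disjoint_ball ?_).mono inter_subset_left inter_subset_left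
    linarith [hsep y hy z hz hyz]
  have hsum : ∑ y ∈ T, ν (ball y (s / 2) ∩ Ω) ≤ ν (ball x (R + s / 2) ∩ Ω) := by
    rw [← measure_biUnion_finset hdisj fun y _ =>
      (isOpen_ball.inter hΩ.isOpen).measurableSet]
    refine measure_mono (iUnion₂_subset fun y hy => inter_subset_inter_left _ ?_)
    exact ball_subset_ball' (by linarith [(hT y hy).2])
  have h1 : ENNReal.ofReal (T.card * ((s / 2) ^ q / Cq)) ≤
      ENNReal.ofReal (Cq * (R + s / 2) ^ q) := by
    refine le_trans ?_ ((Finset.sum_le_sum hlow).trans (hsum.trans hup))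
    rw [Finset.sum_const, nsmul_eq_mul, ENNReal.ofReal_mul (by positivity), ENNReal.ofReal_natCast]
  have hsq : 0 < (s / 2) ^ q := by positivity
  rw [ENNReal.ofReal_le_ofReal_iff (by positivity), mul_div_assoc', div_le_iff₀ hCq0] at h1
  rw [Real.div_rpow (by positivity) hs2.le, mul_div_assoc', le_div_iff₀ hsq]
  linarith

/-- The space need not be proper. Total boundedness comes from the volume count, since a separated
set of maximal cardinality is a net, and completeness does the rest. -/
theorem compactlyContained_ball [CompleteSpace X] [PreconnectedSpace X] [MeasurableSpace X]
    [BorelSpace X] {ν : Measure X} {q Cq : ℝ} (hCq : 1 ≤ Cq) (hΩ : IsBoundedProperDomain Ω)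
    (hν : IsAhlforsRegular ν Ω q Cq) {x : X} (hx : x ∈ Ω) :
    CompactlyContained (ball x (infDist x Ωᶜ / 4)) Ω := by
  set d := infDist x Ωᶜ with hd
  have hd0 : 0 < d := infDist_compl_pos hΩ hx
  have hdd : d ≤ diam Ω := infDist_compl_le_diam hΩ hx
  have hsub : ball x (d / 4) ⊆ Ω :=
    (ball_subset_ball (by linarith)).trans (ball_infDist_compl_subset (x := x))
  refine ⟨?_, ?_⟩
  · refine (TotallyBounded.closure ?_).isCompact_of_isClosed isClosed_closure
    rw [Metric.totallyBounded_iff]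
    intro ε hε
    -- The cap d/4 keeps the radius d/4 + s/2 of the counting ball below the diameter of Ω.
    set s := min ε (d / 4) with hs
    have hs0 : 0 < s := by positivity
    have hsd : s ≤ d / 4 := min_le_right _ _
    set A : Set ℕ := {n | ∃ T : Finset X, T.card = n ∧ (∀ y ∈ T, y ∈ ball x (d / 4)) ∧
      ∀ y ∈ T, ∀ z ∈ T, y ≠ z → s ≤ dist y z} with hA
    have hAne : A.Nonempty := ⟨0, ∅, by simp⟩
    have hAb : BddAbove A := by
      refine ⟨⌊Cq ^ 2 * ((d / 4 + s / 2) / (s / 2)) ^ q⌋₊, ?_⟩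
      rintro n ⟨T, rfl, hT1, hT2⟩
      refine Nat.le_floor (card_le_of_separated hCq hΩ hν hx hs0 (by positivity) (by linarith)
        (fun y hy => ⟨hsub (hT1 y hy), (hT1 y hy).le⟩) hT2)
    obtain ⟨T, hTc, hT1, hT2⟩ := Nat.sSup_mem hAne hAb
    refine ⟨T, T.finite_toSet, fun y hy => ?_⟩
    by_contra hcon
    have hfar : ∀ z ∈ T, s ≤ dist y z := by
      intro z hz
      by_contra h
      push Not at h
      exact hcon (mem_iUnion₂.2 ⟨z, hz, h.trans_le (min_le_left _ _)⟩)
    have hyT : y ∉ T := fun h => by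
      have := hfar y h
      rw [dist_self] at this
      linarith
    classical
    have : (insert y T).card ≤ sSup A := by
      refine le_csSup hAb ⟨insert y T, rfl, ?_, ?_⟩
      · simpa using ⟨hy, fun z hz => by simpa using hT1 z hz⟩
      · intro a ha b hb hab
        rcases Finset.mem_insert.1 ha with ha' | ha' <;>
          rcases Finset.mem_insert.1 hb with hb' | hb'
        · exact absurd (ha'.trans hb'.symm) hab
        · rw [ha']; exact hfar b hb'
        · rw [hb', dist_comm]; exact hfar a ha'
        · exact hT2 a ha' b hb' hab
    rw [Finset.card_insert_of_notMem hyT, hTc] at this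
    omega
  · refine closure_ball_subset_closedBall.trans
      ((closedBall_subset_ball (by linarith)).trans (ball_infDist_compl_subset (x := x)))

/-- The centres of a Whitney type cover of `Ω` by the balls `B(x, δ d(x, Ωᶜ))`. -/
structure IsWhitneySet (Ω : Set X) (δ : ℝ) (S : Set X) : Prop where
  subset : S ⊆ Ω
  separated : ∀ x ∈ S, ∀ y ∈ S, x ≠ y → δ * min (infDist x Ωᶜ) (infDist y Ωᶜ) ≤ dist x y
  cover : ∀ y ∈ Ω, ∃ x ∈ S, y ∈ ball x (δ * infDist x Ωᶜ)

theorem exists_isWhitneySet (hΩ : IsBoundedProperDomain Ω) {δ : ℝ} (hδ : 0 < δ) :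
    ∃ S, IsWhitneySet Ω δ S := by
  obtain ⟨S, hS⟩ := zorn_subset {S : Set X | S ⊆ Ω ∧
      S.Pairwise fun x y => δ * min (infDist x Ωᶜ) (infDist y Ωᶜ) ≤ dist x y} (by
    intro C hC hchain
    refine ⟨⋃₀ C, ⟨sUnion_subset fun s hs => (hC hs).1, ?_⟩, fun s hs => subset_sUnion_of_mem hs⟩
    exact (pairwise_sUnion hchain.directedOn).2 fun s hs => (hC hs).2)
  refine ⟨S, hS.prop.1, fun x hx y hy hxy => hS.prop.2 hx hy hxy, fun y hy => ?_⟩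
  have hdy := infDist_compl_pos hΩ hy
  by_cases hyS : y ∈ S
  · exact ⟨y, hyS, mem_ball_self (by positivity)⟩
  by_contra! hcon
  refine hyS (hS.le_of_ge (y := insert y S) ⟨insert_subset hy hS.prop.1, ?_⟩ (subset_insert _ _)
    (mem_insert _ _))
  have : Std.Symm fun x y : X => δ * min (infDist x Ωᶜ) (infDist y Ωᶜ) ≤ dist x y :=
    ⟨fun a b h => by rwa [min_comm, dist_comm]⟩
  refine (pairwise_insert_of_symm_of_notMem hyS).2 ⟨hS.prop.2, fun x hx => ?_⟩
  · have := hcon x hx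
    rw [mem_ball, not_lt] at this
    refine le_trans ?_ this
    gcongr
    exact min_le_right _ _

/-- Bounded overlap: if B(x, d(x)/4) contains y, then d(x) lies between 4/5 and 4/3 of d(y). Such
centres are within d(y)/3 of y and separated by 4δ d(y)/5, so the volume count applies. -/
theorem IsWhitneySet.card_le [PreconnectedSpace X] [MeasurableSpace X] [BorelSpace X]
    {ν : Measure X} {q Cq : ℝ} (hCq : 1 ≤ Cq) (hΩ : IsBoundedProperDomain Ω)
    (hν : IsAhlforsRegular ν Ω q Cq) {δ : ℝ} (hδ : 0 < δ) (hδ1 : δ ≤ 1) {S : Set X}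
    (hS : IsWhitneySet Ω δ S) {y : X} (hy : y ∈ Ω) {T : Finset X}
    (hT : ∀ x ∈ T, x ∈ S ∧ y ∈ ball x (infDist x Ωᶜ / 4)) :
    (T.card : ℝ) ≤ Cq ^ 2 * ((1 / 3 + 2 * δ / 5) / (2 * δ / 5)) ^ q := by
  set d := infDist y Ωᶜ with hd
  have hd0 : 0 < d := infDist_compl_pos hΩ hy
  have hdd : d ≤ diam Ω := infDist_compl_le_diam hΩ hy
  have hcomp : ∀ x ∈ T, 4 / 5 * d ≤ infDist x Ωᶜ ∧ dist x y ≤ d / 3 := by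
    intro x hx
    have h1 := (hT x hx).2
    rw [mem_ball] at h1
    have h2 : d ≤ infDist x Ωᶜ + dist y x := infDist_le_infDist_add_dist
    have h3 : infDist x Ωᶜ ≤ d + dist x y := infDist_le_infDist_add_dist
    rw [dist_comm x y] at *
    constructor <;> linarith
  have hs : 0 < δ * (4 / 5 * d) := by positivity
  have := card_le_of_separated hCq hΩ hν hy (R := d / 3) (s := δ * (4 / 5 * d)) (T := T) hs
    (by positivity) (by nlinarith) (fun x hx => ⟨hS.subset (hT x hx).1, (hcomp x hx).2⟩) (by
      intro x hx z hz hxz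
      refine le_trans ?_ (hS.separated x (hT x hx).1 z (hT z hz).1 hxz)
      gcongr
      exact le_min (hcomp x hx).1 (hcomp z hz).1)
  convert this using 3
  field_simp
  ring

/-- The integrals over the Whitney balls of an integrable function are summable. -/
theorem IsWhitneySet.summable_integral [PreconnectedSpace X] [MeasurableSpace X] [BorelSpace X]
    {ν : Measure X} {q Cq : ℝ} (hCq : 1 ≤ Cq) (hΩ : IsBoundedProperDomain Ω)
    (hν : IsAhlforsRegular ν Ω q Cq) {δ : ℝ} (hδ : 0 < δ) (hδ1 : δ ≤ 1) {S : Set X}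
    (hS : IsWhitneySet Ω δ S) {α : X → ℝ} (hα : IntegrableOn α Ω ν) (hα0 : ∀ x ∈ Ω, 0 ≤ α x) :
    Summable fun x : S => ∫ y in ball (x : X) (infDist (x : X) Ωᶜ / 4), α y ∂ν := by
  classical
  have hsub : ∀ x ∈ S, ball x (infDist x Ωᶜ / 4) ⊆ Ω := fun x hx =>
    (ball_subset_ball (by linarith [infDist_nonneg (x := x) (s := Ωᶜ)])).trans
      (ball_infDist_compl_subset (x := x))
  set N := Cq ^ 2 * ((1 / 3 + 2 * δ / 5) / (2 * δ / 5)) ^ q with hN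
  refine summable_of_sum_le (c := N * ∫ y in Ω, α y ∂ν) (fun x =>
    setIntegral_nonneg isOpen_ball.measurableSet fun y hy => hα0 y (hsub x x.2 hy)) fun F => ?_
  have h1 : ∀ x ∈ F, ∫ y in ball (x : X) (infDist (x : X) Ωᶜ / 4), α y ∂ν =
      ∫ y in Ω, (ball (x : X) (infDist (x : X) Ωᶜ / 4)).indicator α y ∂ν := by
    intro x _
    rw [setIntegral_indicator isOpen_ball.measurableSet, inter_eq_right.2 (hsub x x.2)]
  rw [Finset.sum_congr rfl h1, ← integral_finsetSum _ fun x _ =>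
    hα.indicator isOpen_ball.measurableSet, ← integral_const_mul]
  refine setIntegral_mono_on (integrable_finsetSum _ fun x _ =>
    hα.indicator isOpen_ball.measurableSet) (hα.const_mul N) hΩ.isOpen.measurableSet fun y hy => ?_
  have h2 : ∑ x ∈ F, (ball (x : X) (infDist (x : X) Ωᶜ / 4)).indicator α y =
      ((F.filter fun x : S => y ∈ ball (x : X) (infDist (x : X) Ωᶜ / 4)).card : ℝ) * α y := by
    simp only [indicator_apply]
    rw [← Finset.sum_filter, Finset.sum_const, nsmul_eq_mul]
  rw [h2]
  refine mul_le_mul_of_nonneg_right ?_ (hα0 y hy)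
  rw [← Finset.card_map (Function.Embedding.subtype _)]
  refine hS.card_le hCq hΩ hν hδ hδ1 hy fun x hx => ?_
  obtain ⟨z, hz, rfl⟩ := Finset.mem_map.1 hx
  exact ⟨z.2, (Finset.mem_filter.1 hz).2⟩

end Geometry

/-! ### John curves: limits, shadows and the number of Whitney balls met. -/

section Curves

variable {X : Type*} [MetricSpace X] {Ω : Set X}

theorem tendsto_infDist_compl_of_tendsto_frontier (hΩ : IsBoundedProperDomain Ω) {ω : X}
    (hω : ω ∈ frontier Ω) {γ : ℝ → X} {l : Filter ℝ} (hγ : Tendsto γ l (𝓝 ω)) :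
    Tendsto (fun t => infDist (γ t) Ωᶜ) l (𝓝 0) := by
  have h0 : infDist ω Ωᶜ = 0 := by
    refine infDist_zero_of_mem ?_
    rw [hΩ.isOpen.frontier_eq] at hω
    exact hω.2
  rw [← h0]
  exact ((continuous_infDist_pt _).tendsto ω).comp hγ

/-- If the oscillations of `f` on the small Whitney balls that meet a curve with an endpoint on the
frontier are summable, then `f` has a limit along the curve. -/
theorem IsWhitneySet.exists_tendsto_of_summable {Y : Type*} [MetricSpace Y] [CompleteSpace Y]
    (hΩ : IsBoundedProperDomain Ω) {δ : ℝ} (hδ1 : δ ≤ 1 / 4) {S : Set X}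
    (hS : IsWhitneySet Ω δ S) {ω : X} (hω : ω ∈ frontier Ω) {γ : ℝ → X}
    (hγc : ContinuousOn γ (Ioc 0 1)) (hγΩ : MapsTo γ (Ioc 0 1) Ω)
    (hγ : Tendsto γ (𝓝[>] 0) (𝓝 ω)) {f : X → Y} {u : X → ℝ} {r₀ : ℝ} (hr₀ : 0 < r₀)
    (hu0 : ∀ x, 0 ≤ u x)
    (hu : ∀ x ∈ S, infDist x Ωᶜ ≤ r₀ →
      ediam (f '' ball x (δ * infDist x Ωᶜ)) ≤ ENNReal.ofReal (u x))
    (hsum : Summable ({x | x ∈ S ∧ infDist x Ωᶜ ≤ r₀ ∧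
      ∃ t ∈ Ioc (0 : ℝ) 1, γ t ∈ ball x (δ * infDist x Ωᶜ)}.indicator u)) :
    ∃ y : Y, Tendsto (fun t => f (γ t)) (𝓝[>] 0) (𝓝 y) := by
  classical
  refine cauchy_map_iff_exists_tendsto.1 ?_
  refine Metric.cauchy_iff.2 ⟨inferInstance, fun ε hε => ?_⟩
  obtain ⟨F, hF⟩ := summable_iff_vanishing_norm.1 hsum ε hε
  have hd := tendsto_infDist_compl_of_tendsto_frontier hΩ hω hγ
  -- As δ ≤ 1/4, meeting the ball of x forces d(γ t) ≥ (3/4) d(x). Near its endpoint the curve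
  -- therefore avoids the balls centred in F and meets only balls of size at most r₀, so only the
  -- tail of the sum matters.
  have hev : ∀ᶠ t in 𝓝[>] (0 : ℝ), infDist (γ t) Ωᶜ < 3 / 4 * r₀ ∧
      ∀ x ∈ F, x ∈ Ω → infDist (γ t) Ωᶜ < 3 / 4 * infDist x Ωᶜ := by
    refine (hd.eventually (gt_mem_nhds (by positivity))).and ((eventually_all_finset F).2 ?_)
    intro x _
    by_cases hx : x ∈ Ω
    · have := infDist_compl_pos hΩ hx
      filter_upwards [hd.eventually (gt_mem_nhds (show 0 < 3 / 4 * infDist x Ωᶜ by positivity))]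
        with t ht _ using ht
    · exact Eventually.of_forall fun t h => absurd h hx
  obtain ⟨t₀, ht₀, hsub⟩ := mem_nhdsGT_iff_exists_Ioc_subset.1
    (hev.and (Ioc_mem_nhdsGT (zero_lt_one' ℝ)))
  have key : ∀ s t, s ∈ Ioc 0 t₀ → t ∈ Ioc 0 t₀ → s ≤ t → dist (f (γ s)) (f (γ t)) < ε := by
    intro s t hs ht hst
    have hIcc : ∀ r ∈ Icc s t, r ∈ Ioc 0 t₀ := fun r hr =>
      ⟨hs.1.trans_le hr.1, hr.2.trans ht.2⟩
    have hIcc1 : Icc s t ⊆ Ioc 0 1 := fun r hr => (hsub (hIcc r hr)).2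
    have hcont : ContinuousOn γ (Icc s t) := hγc.mono hIcc1
    have hcov : γ '' Icc s t ⊆ ⋃ x ∈ S, ball x (δ * infDist x Ωᶜ) := by
      rintro _ ⟨r, hr, rfl⟩
      obtain ⟨x, hx, hxr⟩ := hS.cover _ (hγΩ (hIcc1 hr))
      exact mem_iUnion₂.2 ⟨x, hx, hxr⟩
    obtain ⟨b, hbS, hbf, hbcov⟩ := (isCompact_Icc.image_of_continuousOn hcont).elim_finite_subcover_image
      (fun x _ => isOpen_ball) hcov
    set G := hbf.toFinset.filter fun x => ∃ r ∈ Icc s t, γ r ∈ ball x (δ * infDist x Ωᶜ) with hG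
    have hGmem : ∀ x ∈ G, x ∈ S ∧ ∃ r ∈ Icc s t, γ r ∈ ball x (δ * infDist x Ωᶜ) := by
      intro x hx
      rw [hG, Finset.mem_filter, hbf.mem_toFinset] at hx
      exact ⟨hbS hx.1, hx.2⟩
    have hsmall : ∀ x ∈ S, ∀ r ∈ Icc s t, γ r ∈ ball x (δ * infDist x Ωᶜ) →
        3 / 4 * infDist x Ωᶜ ≤ infDist (γ r) Ωᶜ := by
      intro x _ r _ hxr
      have h1 : infDist x Ωᶜ ≤ infDist (γ r) Ωᶜ + dist x (γ r) := infDist_le_infDist_add_dist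
      rw [mem_ball, dist_comm] at hxr
      nlinarith [infDist_nonneg (x := x) (s := Ωᶜ)]
    have hGr : ∀ x ∈ G, infDist x Ωᶜ ≤ r₀ := by
      intro x hx
      obtain ⟨hxS, r, hr, hxr⟩ := hGmem x hx
      linarith [hsmall x hxS r hr hxr, (hsub (hIcc r hr)).1.1]
    have hGF : Disjoint G F := by
      refine Finset.disjoint_left.2 fun x hx hxF => ?_
      obtain ⟨hxS, r, hr, hxr⟩ := hGmem x hx
      linarith [hsmall x hxS r hr hxr, (hsub (hIcc r hr)).1.2 x hxF (hS.subset hxS)]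
    have h1 : edist (f (γ s)) (f (γ t)) ≤
        ∑ x ∈ G, ediam (f '' ball x (δ * infDist x Ωᶜ)) := by
      refine edist_le_sum_ediam_of_isPreconnected (A := γ '' Icc s t)
        (isPreconnected_Icc.image _ hcont) (fun x => isOpen_ball) G ?_
        (mem_image_of_mem _ (left_mem_Icc.2 hst)) (mem_image_of_mem _ (right_mem_Icc.2 hst))
      rintro _ ⟨r, hr, rfl⟩
      obtain ⟨x, hx, hxr⟩ := mem_iUnion₂.1 (hbcov (mem_image_of_mem _ hr))
      refine mem_iUnion₂.2 ⟨x, ?_, hxr⟩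
      exact Finset.mem_filter.2 ⟨hbf.mem_toFinset.2 hx, r, hr, hxr⟩
    have h2 : ∑ x ∈ G, ediam (f '' ball x (δ * infDist x Ωᶜ)) ≤
        ENNReal.ofReal (∑ x ∈ G, u x) := by
      rw [ENNReal.ofReal_sum_of_nonneg fun x _ => hu0 x]
      exact Finset.sum_le_sum fun x hx => hu x (hGmem x hx).1 (hGr x hx)
    have h3 : ∑ x ∈ G, u x < ε := by
      have := (le_abs_self _).trans_lt (hF G hGF)
      rwa [Finset.sum_congr rfl fun x hx => indicator_of_mem (s := {x | x ∈ S ∧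
        infDist x Ωᶜ ≤ r₀ ∧ ∃ t ∈ Ioc (0 : ℝ) 1, γ t ∈ ball x (δ * infDist x Ωᶜ)}) ?_ u] at this
      obtain ⟨hxS, r, hr, hxr⟩ := hGmem x hx
      exact ⟨hxS, hGr x hx, r, hIcc1 hr, hxr⟩
    rw [← edist_lt_ofReal]
    exact (h1.trans h2).trans_lt ((ENNReal.ofReal_lt_ofReal_iff hε).2 h3)
  refine ⟨_, image_mem_map (Ioc_mem_nhdsGT ht₀), ?_⟩
  rintro _ ⟨s, hs, rfl⟩ _ ⟨t, ht, rfl⟩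
  rcases le_total s t with h | h
  · exact key s t hs ht h
  · rw [dist_comm]
    exact key t s ht hs h

/-- Length dominates the distance from γ s to γ t; let s tend to 0. The John condition enters the
argument only through this estimate. -/
theorem dist_le_of_mem_boundaryJohnCurves {φ : ℝ → ℝ} {c : ℝ} (hφ : IsJohnFunction φ) (hc : 0 ≤ c)
    {ω x₀ : X} {γ : ℝ → X} (hγ : γ ∈ boundaryJohnCurves Ω φ c ω x₀) {t : ℝ} (ht : t ∈ Ioc 0 1) :
    dist ω (γ t) ≤ φ (c * infDist (γ t) Ωᶜ) := by
  obtain ⟨-, -, hlim, -, hlen⟩ := hγ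
  have hnn : 0 ≤ φ (c * infDist (γ t) Ωᶜ) := by
    rw [← hφ.map_zero]
    have : 0 ≤ c * infDist (γ t) Ωᶜ := mul_nonneg hc infDist_nonneg
    exact hφ.monotoneOn (mem_Ici.2 le_rfl) this this
  rw [← ENNReal.ofReal_le_ofReal_iff hnn, ← edist_dist]
  refine le_trans ?_ (hlen t ht)
  refine le_of_tendsto (hlim.edist tendsto_const_nhds) ?_
  filter_upwards [Ioc_mem_nhdsGT ht.1] with s hs
  exact eVariationOn.edist_le γ hs (right_mem_Ioc.2 ht.1)

theorem IsJohnFunction.nonneg {φ : ℝ → ℝ} (hφ : IsJohnFunction φ) {t : ℝ} (ht : 0 ≤ t) :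
    0 ≤ φ t := by
  rw [← hφ.map_zero]
  exact hφ.monotoneOn (mem_Ici.2 le_rfl) ht ht

/-- The shadow of a Whitney ball is contained in a ball. -/
theorem dist_le_of_mem_ball_of_mem_boundaryJohnCurves {φ : ℝ → ℝ} {c : ℝ} (hφ : IsJohnFunction φ)
    (hc : 1 ≤ c) {ω x₀ : X} {γ : ℝ → X} (hγ : γ ∈ boundaryJohnCurves Ω φ c ω x₀) {x : X} {δ t : ℝ}
    (hδ1 : δ ≤ 1) (ht : t ∈ Ioc 0 1)
    (hx : γ t ∈ ball x (δ * infDist x Ωᶜ)) :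
    dist ω x ≤ 2 * φ (2 * c * infDist x Ωᶜ) := by
  set d := infDist x Ωᶜ with hd
  have hd0 : 0 ≤ d := infDist_nonneg
  rw [mem_ball] at hx
  have h1 : infDist (γ t) Ωᶜ ≤ d + dist (γ t) x := infDist_le_infDist_add_dist
  have h2 : infDist (γ t) Ωᶜ ≤ 2 * d := by nlinarith
  have h3 : φ (c * infDist (γ t) Ωᶜ) ≤ φ (2 * c * d) := by
    refine hφ.monotoneOn (mul_nonneg (by linarith) infDist_nonneg) ?_ (by nlinarith)
    exact mul_nonneg (by linarith) hd0
  have h4 : δ * d ≤ φ (2 * c * d) := by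
    rcases hd0.eq_or_lt with h | h
    · rw [← h] at hx
      simp only [mul_zero] at hx
      exact absurd hx (not_lt.2 dist_nonneg)
    · have := hφ.le_map (2 * c * d) (by positivity)
      nlinarith
  linarith [dist_triangle ω (γ t) x, dist_le_of_mem_boundaryJohnCurves hφ (by linarith) hγ ht]

/-- The number of Whitney balls of a given size that meet a John curve. -/
theorem IsWhitneySet.card_le_of_mem_boundaryJohnCurves [MeasurableSpace X] [BorelSpace X]
    {ν : Measure X} {q Cq : ℝ} (hq : 0 ≤ q) (hCq : 1 ≤ Cq) (hΩ : IsBoundedProperDomain Ω)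
    (hν : IsAhlforsRegular ν Ω q Cq) {δ : ℝ} (hδ : 0 < δ) (hδ1 : δ ≤ 1) {S : Set X}
    (hS : IsWhitneySet Ω δ S) {φ : ℝ → ℝ} {c : ℝ} (hφ : IsJohnFunction φ)
    (hc : 1 ≤ c) {ω x₀ : X} {γ : ℝ → X} (hγ : γ ∈ boundaryJohnCurves Ω φ c ω x₀)
    {r : ℝ} (hr : 0 < r) (hrΩ : 5 * φ (2 * c * r) < diam Ω) {T : Finset X}
    (hT : ∀ x ∈ T, x ∈ S ∧ r / 2 ≤ infDist x Ωᶜ ∧ infDist x Ωᶜ ≤ r ∧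
      ∃ t ∈ Ioc (0 : ℝ) 1, γ t ∈ ball x (δ * infDist x Ωᶜ)) :
    (T.card : ℝ) ≤ Cq ^ 2 * (40 * c / δ) ^ q * (φ (2 * c * r) / (2 * c * r)) ^ q := by
  have hT0 : 0 < 2 * c * r := by positivity
  have hφT : 2 * c * r ≤ φ (2 * c * r) := hφ.le_map _ hT0
  have hφ0 : 0 < φ (2 * c * r) := hT0.trans_le hφT
  have hδr : δ * r ≤ 1 * r := by gcongr
  have hcr : 1 * r ≤ c * r := by gcongr
  rcases T.eq_empty_or_nonempty with rfl | ⟨x, hx⟩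
  · simp only [Finset.card_empty, Nat.cast_zero]
    positivity
  have hω : ∀ y ∈ T, dist ω y ≤ 2 * φ (2 * c * r) := by
    intro y hy
    obtain ⟨-, -, h2, t, ht, hyt⟩ := hT y hy
    refine (dist_le_of_mem_ball_of_mem_boundaryJohnCurves hφ hc hγ hδ1 ht hyt).trans ?_
    gcongr
    refine hφ.monotoneOn (mul_nonneg (by positivity) infDist_nonneg) hT0.le (by gcongr)
  -- All centres are within 2φ(2cr) of ω, hence within 4φ(2cr) of one another, and are δr/2
  -- separated. The final constant is 5φ(2cr)/(δr/4) = (40c/δ) φ(2cr)/(2cr).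
  have key := card_le_of_separated hCq hΩ hν (hS.subset (hT x hx).1) (R := 4 * φ (2 * c * r))
    (s := δ * (r / 2)) (T := T) (by positivity) (by positivity) (by linarith)
    (fun y hy => ⟨hS.subset (hT y hy).1, by
      linarith [dist_triangle_left y x ω, hω x hx, hω y hy]⟩) (by
      intro y hy z hz hyz
      refine le_trans ?_ (hS.separated y (hT y hy).1 z (hT z hz).1 hyz)
      gcongr
      exact le_min (hT y hy).2.1 (hT z hz).2.1)
  refine key.trans ?_
  rw [mul_assoc (Cq ^ 2), ← Real.mul_rpow (by positivity) (by positivity)]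
  gcongr
  rw [div_mul_div_comm, div_le_div_iff₀ (by positivity) (by positivity)]
  have h5 : 4 * φ (2 * c * r) + δ * (r / 2) / 2 ≤ 5 * φ (2 * c * r) := by linarith
  calc (4 * φ (2 * c * r) + δ * (r / 2) / 2) * (δ * (2 * c * r))
      ≤ 5 * φ (2 * c * r) * (δ * (2 * c * r)) := by gcongr
    _ = _ := by ring

end Curves

/-! ### Gauges and dyadic sums. -/

theorem IsDoublingGauge.nonneg {h : ℝ → ℝ} (hh : IsDoublingGauge h) {t : ℝ} (ht : 0 ≤ t) :
    0 ≤ h t := by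
  rw [← hh.map_zero]
  exact hh.monotoneOn (mem_Ici.2 le_rfl) ht ht

/-- The factor 16 is the diameter bound for a shadow of radius 2φ enlarged four times. -/
theorem IsDoublingGauge.exists_le_mul {h : ℝ → ℝ} (hh : IsDoublingGauge h) :
    ∃ C, 0 ≤ C ∧ ∀ t, 0 ≤ t → h (16 * t) ≤ C * h t := by
  obtain ⟨C, hC⟩ := hh.doubling
  have hC' : ∀ t, 0 ≤ t → h (2 * t) ≤ |C| * h t := by
    intro t ht
    rcases ht.eq_or_lt with rfl | ht
    · simp [hh.map_zero]
    · exact (hC t ht).trans (mul_le_mul_of_nonneg_right (le_abs_self _) (hh.nonneg ht.le))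
  refine ⟨|C| ^ 4, by positivity, fun t ht => ?_⟩
  calc h (16 * t) = h (2 * (2 * (2 * (2 * t)))) := by ring_nf
    _ ≤ |C| * (|C| * (|C| * (|C| * h t))) := by
        refine (hC' _ (by positivity)).trans ?_
        gcongr
        refine (hC' _ (by positivity)).trans ?_
        gcongr
        refine (hC' _ (by positivity)).trans ?_
        gcongr
        exact hC' _ ht
    _ = _ := by ring

/-- The dyadic form of the integral condition on the gauge. -/
theorem summable_of_integrableOn {φ h L : ℝ → ℝ} {q p a : ℝ} (hq : 0 ≤ q) (hp : 0 ≤ p)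
    (ha : 0 < a) (ha1 : a < 1) (hφ : IsJohnFunction φ) (hh : IsDoublingGauge h)
    (hL0 : ∀ t ∈ Ioo (0 : ℝ) 1, 0 ≤ L t) (hL : AntitoneOn L (Ioo 0 1))
    (hint : IntegrableOn (fun t : ℝ => (φ t / t) ^ q * h (φ t) ^ p * L t ^ p * (1 / t))
      (Ioo 0 1)) :
    Summable fun k : ℕ => (φ (a * (1 / 2) ^ (k + 1)) / (a * (1 / 2) ^ (k + 1))) ^ q *
      h (φ (a * (1 / 2) ^ (k + 1))) ^ p * L (a * (1 / 2) ^ k) ^ p := by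
  set τ : ℕ → ℝ := fun k => a * (1 / 2) ^ k with hτ
  have hτ0 : ∀ k, 0 < τ k := fun k => by positivity
  have hτa : Antitone τ := fun m n hmn =>
    mul_le_mul_of_nonneg_left (pow_le_pow_of_le_one (by norm_num) (by norm_num) hmn) ha.le
  have hτ1 : ∀ k, τ k < 1 := fun k => (hτa k.zero_le).trans_lt (by simpa [hτ] using ha1)
  have hτs : ∀ k, τ (k + 1) = τ k / 2 := fun k => by simp only [hτ, pow_succ]; ring
  have hsub : ∀ k, Ico (τ (k + 1)) (τ k) ⊆ Ioo 0 1 := fun k t ht =>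
    ⟨(hτ0 _).trans_le ht.1, ht.2.trans (hτ1 k)⟩
  have hsum := (hasSum_integral_iUnion (fun k => measurableSet_Ico)
    (hτa.pairwise_disjoint_on_Ico_succ) (hint.mono_set (iUnion_subset hsub))).summable
  refine Summable.of_nonneg_of_le (fun k => ?_) (fun k => ?_) (hsum.mul_left (2 * 2 ^ q))
  · have h1 := hφ.nonneg (hτ0 (k + 1)).le
    exact mul_nonneg (mul_nonneg (Real.rpow_nonneg (div_nonneg h1 (hτ0 _).le) _)
      (Real.rpow_nonneg (hh.nonneg h1) _)) (Real.rpow_nonneg (hL0 _ ⟨hτ0 k, hτ1 k⟩) _)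
  · change (φ (τ (k + 1)) / τ (k + 1)) ^ q * h (φ (τ (k + 1))) ^ p * L (τ k) ^ p ≤ _
    have h0 := hφ.nonneg (hτ0 (k + 1)).le
    have hL' := hL0 _ ⟨hτ0 k, hτ1 k⟩
    set A := (φ (τ (k + 1)) / τ (k + 1)) ^ q * h (φ (τ (k + 1))) ^ p * L (τ k) ^ p with hA
    -- On one dyadic interval φ and h ∘ φ are smallest at the left end and L at the right end,
    -- whence the shifted index. The loss 2^q comes from t ≤ 2 τ (k + 1), and the other 2 from the
    -- length τ k / 2.
    have key := setIntegral_ge_of_const_le_real (μ := volume) (s := Ico (τ (k + 1)) (τ k))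
      (c := A / 2 ^ q * (1 / τ k))
      (f := fun t : ℝ => (φ t / t) ^ q * h (φ t) ^ p * L t ^ p * (1 / t)) measurableSet_Ico
      (by simp) (fun t ht => ?_) (hint.mono_set (hsub k))
    · rw [Real.volume_real_Ico_of_le (hτa k.le_succ), show τ k - τ (k + 1) = τ k - τ k / 2 by
        rw [hτs k]] at key
      have h2 : A / 2 ^ q * (1 / τ k) * (τ k - τ k / 2) = A / (2 * 2 ^ q) := by
        have := (hτ0 k).ne'
        field_simp
        ring
      rw [h2, div_le_iff₀ (by positivity), mul_comm] at key
      exact key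
    · have ht0 : 0 < t := (hsub k ht).1
      have hφt : φ (τ (k + 1)) ≤ φ t := hφ.monotoneOn (hτ0 _).le ht0.le ht.1
      have hq' : (φ (τ (k + 1)) / τ (k + 1)) ^ q ≤ 2 ^ q * (φ t / t) ^ q := by
        rw [← Real.mul_rpow (by norm_num) (div_nonneg (h0.trans hφt) ht0.le)]
        refine Real.rpow_le_rpow (div_nonneg h0 (hτ0 _).le) ?_ hq
        rw [mul_div_assoc', div_le_div_iff₀ (hτ0 _) ht0]
        have : t ≤ 2 * τ (k + 1) := by rw [hτs]; linarith [ht.2]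
        calc φ (τ (k + 1)) * t ≤ φ t * (2 * τ (k + 1)) := by
              gcongr
              exact h0.trans hφt
          _ = _ := by ring
      have hA' : A / 2 ^ q ≤ (φ t / t) ^ q * h (φ t) ^ p * L t ^ p := by
        rw [div_le_iff₀ (by positivity), hA]
        have e1 : h (φ (τ (k + 1))) ^ p ≤ h (φ t) ^ p :=
          Real.rpow_le_rpow (hh.nonneg h0) (hh.monotoneOn h0 (h0.trans hφt) hφt) hp
        have e2 : L (τ k) ^ p ≤ L t ^ p :=
          Real.rpow_le_rpow hL' (hL (hsub k ht) ⟨hτ0 k, hτ1 k⟩ ht.2.le) hp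
        have e3 : 0 ≤ h (φ (τ (k + 1))) ^ p := Real.rpow_nonneg (hh.nonneg h0) _
        have e4 : 0 ≤ L (τ k) ^ p := Real.rpow_nonneg hL' _
        have e5 : 0 ≤ 2 ^ q * (φ t / t) ^ q :=
          (Real.rpow_nonneg (div_nonneg h0 (hτ0 _).le) q).trans hq'
        have e6 : 0 ≤ h (φ t) ^ p := e3.trans e1
        calc _ ≤ 2 ^ q * (φ t / t) ^ q * h (φ t) ^ p * L t ^ p := by
              refine mul_le_mul (mul_le_mul hq' e1 e3 e5) e2 e4 (mul_nonneg e5 e6)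
          _ = _ := by ring
      refine mul_le_mul hA' (one_div_le_one_div_of_le ht0 ht.2.le) (by have := hτ0 k; positivity) ?_
      refine mul_nonneg (mul_nonneg (Real.rpow_nonneg (div_nonneg (h0.trans hφt) ht0.le) _)
        (Real.rpow_nonneg (hh.nonneg (h0.trans hφt)) _)) (Real.rpow_nonneg (hL0 t (hsub k ht)) _)

theorem summable_indicator_of_card_fiber_le {ι : Type*} (κ : ι → ℕ) {g N : ℕ → ℝ}
    (hg : ∀ k, 0 ≤ g k) {P : Set ι}
    (hcard : ∀ (k : ℕ) (T : Finset ι), (∀ i ∈ T, i ∈ P ∧ κ i = k) → (T.card : ℝ) ≤ N k)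
    (hs : Summable fun k => N k * g k) : Summable (P.indicator fun i => g (κ i)) := by
  classical
  have hN : ∀ k, 0 ≤ N k := fun k => by simpa using hcard k ∅ (by simp)
  refine summable_of_sum_le (fun i => indicator_nonneg (fun i _ => hg _) i)
    (c := ∑' k, N k * g k) fun F => ?_
  simp only [indicator_apply]
  rw [← Finset.sum_filter, ← Finset.sum_fiberwise_of_maps_to
    (fun i hi => Finset.mem_image_of_mem κ hi)]
  refine (Finset.sum_le_sum fun k _ => ?_).trans
    (hs.sum_le_tsum _ fun k _ => mul_nonneg (hN k) (hg k))
  rw [Finset.sum_congr rfl fun i hi => by rw [(Finset.mem_filter.1 hi).2], Finset.sum_const,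
    nsmul_eq_mul]
  refine mul_le_mul_of_nonneg_right (hcard k _ fun i hi => ?_) (hg k)
  obtain ⟨h1, h2⟩ := Finset.mem_filter.1 hi
  exact ⟨(Finset.mem_filter.1 h1).2, h2⟩

/-- Used to make the weights strictly positive, even where h vanishes, at a summable cost. -/
theorem exists_pos_mul_rpow_le {N l p ε : ℝ} (hp : 0 < p) (hε : 0 < ε) :
    ∃ η : ℝ, 0 < η ∧ N * (η * l) ^ p ≤ ε := by
  have h1 : Tendsto (fun η : ℝ => N * (η * l) ^ p) (𝓝[>] 0) (𝓝 0) := by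
    have : ContinuousAt (fun η : ℝ => N * (η * l) ^ p) 0 :=
      continuousAt_const.mul ((continuousAt_id.mul continuousAt_const).rpow_const (Or.inr hp.le))
    have h2 := this.tendsto
    simp only [zero_mul, Real.zero_rpow hp.ne', mul_zero] at h2
    exact h2.mono_left nhdsWithin_le_nhds
  obtain ⟨η, h2, h3⟩ := ((h1.eventually (gt_mem_nhds hε)).and self_mem_nhdsWithin).exists
  exact ⟨η, h3, h2.le⟩

theorem setIntegral_ball_infDist_nonneg {X : Type*} [MetricSpace X] [MeasurableSpace X]
    [BorelSpace X] {ν : Measure X} {Ω : Set X} {α : X → ℝ} (hα0 : ∀ x ∈ Ω, 0 ≤ α x) (x : X) :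
    0 ≤ ∫ y in ball x (infDist x Ωᶜ / 4), α y ∂ν :=
  setIntegral_nonneg isOpen_ball.measurableSet fun y hy => hα0 y (ball_infDist_compl_subset (x := x)
    (ball_subset_ball (by linarith [infDist_nonneg (x := x) (s := Ωᶜ)]) hy))

/-! ### The exceptional set and its gauge measure. -/

section Main

variable {X : Type*} {Y : Type*} [MetricSpace X] [PreconnectedSpace X] [MeasurableSpace X]
  [BorelSpace X] [MetricSpace Y] [CompleteSpace Y]
  {ν : Measure X} {Ω : Set X} {x₀ : X} {q Cq c : ℝ} {φ h L : ℝ → ℝ} {f : X → Y}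

/-- The exceptional set is covered by enlarged shadows of small Whitney balls, with arbitrarily
small total gauge. -/
theorem exists_countable_cover_exceptionalSet (hq : 1 < q) (hCq : 1 ≤ Cq) (hc : 1 ≤ c)
    (hφ : IsJohnFunction φ) (hΩ : IsBoundedProperDomain Ω) (hν : IsAhlforsRegular ν Ω q Cq)
    (hh : IsDoublingGauge h) (hL0 : ∀ t ∈ Ioo (0 : ℝ) 1, 0 ≤ L t) (hL : AntitoneOn L (Ioo 0 1))
    {α : X → ℝ} {C : ℝ} (hα : IntegrableOn α Ω ν) (hα0 : ∀ x ∈ Ω, 0 ≤ α x) (hC : 0 ≤ C)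
    {δ : ℝ} (hδ : 0 < δ) (hδ1 : δ ≤ 1 / 4) {k₀ : ℕ}
    (hf : ∀ x ∈ Ω, ∀ k ≥ k₀, (1 / 2) ^ (k + 1) < infDist x Ωᶜ → infDist x Ωᶜ ≤ (1 / 2) ^ k →
      ediam (f '' ball x (δ * infDist x Ωᶜ)) ≤ ENNReal.ofReal
        (C * (∫ y in ball x (infDist x Ωᶜ / 4), α y ∂ν) ^ (1 / q) *
          L (4 * c * (1 / 2) ^ k) ^ (1 / q)))
    (hint : IntegrableOn (fun t : ℝ => (φ t / t) ^ q * h (φ t) ^ (1 / (q - 1)) *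
      L t ^ (1 / (q - 1)) * (1 / t)) (Ioo 0 1)) (n : ℕ) {ε : ℝ} (hε : 0 < ε) :
    ∃ J : Set X, J.Countable ∧ (∀ x ∈ J, infDist x Ωᶜ ≤ (1 / 2) ^ n) ∧
      exceptionalSet Ω φ c x₀ f ⊆ ⋃ x : J, closedBall (x : X) (8 * φ (2 * c * infDist (x : X) Ωᶜ)) ∧
      ∑' x : J, ENNReal.ofReal (h (φ (2 * c * infDist (x : X) Ωᶜ))) ≤ ENNReal.ofReal ε := by
  have hq0 : 0 < q := by linarith
  have hc0 : 0 < c := by linarith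
  set p := 1 / (q - 1) with hp
  have hp0 : 0 < p := one_div_pos.2 (by linarith)
  obtain ⟨S, hS⟩ := exists_isWhitneySet hΩ hδ
  have hpow : Tendsto (fun k : ℕ => (1 / 2 : ℝ) ^ k) atTop (𝓝 0) :=
    tendsto_pow_atTop_nhds_zero_of_lt_one (by norm_num) (by norm_num)
  -- the scale `1 / 2 ^ K` below which all estimates hold
  obtain ⟨x', hx'⟩ := hΩ.isConnected.nonempty
  have hdiam : 0 < diam Ω := (infDist_compl_pos hΩ hx').trans_le (infDist_compl_le_diam hΩ hx')
  -- This puts the argument of L in (0, 1); the next condition keeps the counting balls in the range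
  -- of Ahlfors regularity.
  have hev1 : ∀ᶠ k : ℕ in atTop, 4 * c * (1 / 2 : ℝ) ^ k < 1 := by
    have := hpow.const_mul (4 * c)
    rw [mul_zero] at this
    exact this.eventually (gt_mem_nhds one_pos)
  have hev2 : ∀ᶠ k : ℕ in atTop, 5 * φ (2 * c * (1 / 2 : ℝ) ^ k) < diam Ω := by
    have h1 : Tendsto (fun k : ℕ => 2 * c * (1 / 2 : ℝ) ^ k) atTop (𝓝[Ici 0] 0) := by
      refine tendsto_nhdsWithin_iff.2 ⟨by simpa using hpow.const_mul (2 * c), ?_⟩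
      exact Eventually.of_forall fun k => mem_Ici.2 (by positivity)
    have h2 := ((hφ.continuousOn 0 (mem_Ici.2 le_rfl)).tendsto.comp h1).const_mul 5
    rw [hφ.map_zero, mul_zero] at h2
    exact h2.eventually (gt_mem_nhds hdiam)
  obtain ⟨K₁, hK₁⟩ := eventually_atTop.1 (hev1.and hev2)
  set K := max n (max k₀ K₁) with hK
  have hKn : n ≤ K := le_max_left _ _
  have hKk : k₀ ≤ K := (le_max_left _ _).trans (le_max_right _ _)
  have hKK : K₁ ≤ K := (le_max_right _ _).trans (le_max_right _ _)
  -- the scale of a point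
  have hκ : ∀ x : X, 0 < infDist x Ωᶜ ∧ infDist x Ωᶜ ≤ 1 → ∃ k : ℕ,
      (1 / 2 : ℝ) ^ (k + 1) < infDist x Ωᶜ ∧ infDist x Ωᶜ ≤ (1 / 2) ^ k := fun x hx =>
    exists_nat_pow_near_of_lt_one hx.1 hx.2 (by norm_num) (by norm_num)
  choose! κ hκ using hκ
  set SK : Set X := {x | x ∈ S ∧ infDist x Ωᶜ ≤ (1 / 2) ^ K} with hSK
  have hSKκ : ∀ x ∈ SK, (1 / 2 : ℝ) ^ (κ x + 1) < infDist x Ωᶜ ∧ infDist x Ωᶜ ≤ (1 / 2) ^ (κ x) ∧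
      K ≤ κ x := by
    intro x hx
    have h1 := hκ x ⟨infDist_compl_pos hΩ (hS.subset hx.1),
      hx.2.trans (pow_le_one₀ (by norm_num) (by norm_num))⟩
    refine ⟨h1.1, h1.2, ?_⟩
    have := (pow_lt_pow_iff_right_of_lt_one₀ (by norm_num) (by norm_num)).1 (h1.1.trans_le hx.2)
    omega
  -- the weights
  set T : ℕ → ℝ := fun k => 2 * c * (1 / 2) ^ k with hT
  -- The absolute value only serves the scales k < K; from K on it changes nothing.
  set Λ : ℕ → ℝ := fun k => |L (4 * c * (1 / 2) ^ k)| with hΛ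
  set B : ℝ := Cq ^ 2 * (40 * c / δ) ^ q with hB
  have hB0 : 0 ≤ B := by positivity
  set N : ℕ → ℝ := fun k => B * (φ (T k) / T k) ^ q with hN
  have hT0 : ∀ k, 0 < T k := fun k => by positivity
  have hφT0 : ∀ k, 0 ≤ φ (T k) := fun k => hφ.nonneg (hT0 k).le
  have hN0 : ∀ k, 0 ≤ N k := fun k =>
    mul_nonneg hB0 (Real.rpow_nonneg (div_nonneg (hφT0 k) (hT0 k).le) _)
  have hη : ∀ k : ℕ, ∃ η : ℝ, 0 < η ∧ N k * (η * Λ k) ^ p ≤ (1 / 2) ^ k := fun k =>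
    exists_pos_mul_rpow_le hp0 (by positivity)
  choose η hη0 hη using hη
  set W : ℕ → ℝ := fun k => max (h (φ (T k))) (η k) with hW
  have hW0 : ∀ k, 0 < W k := fun k => lt_max_of_lt_right (hη0 k)
  have hsumW : Summable fun k => N k * (W k * Λ k) ^ p := by
    -- With this a, the points a 2^(-(k+1)) and a 2^(-k) are exactly `T (k + K)` and the argument of
    -- L in `Λ (k + K)`: the one-step shift explains 2c against 4c.
    have hs := summable_of_integrableOn hq0.le hp0.le (a := 4 * c * (1 / 2) ^ K) (by positivity)
      (hK₁ K hKK).1 hφ hh hL0 hL hint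
    rw [← summable_nat_add_iff K]
    have hs2 : Summable fun k : ℕ => (1 / 2 : ℝ) ^ (k + K) :=
      (summable_nat_add_iff K).2 summable_geometric_two
    refine Summable.of_nonneg_of_le (fun k => mul_nonneg (hN0 _) (Real.rpow_nonneg
      (mul_nonneg (hW0 _).le (abs_nonneg _)) _)) (fun k => ?_) ((hs.mul_left B).add hs2)
    have e1 : 4 * c * (1 / 2) ^ K * (1 / 2) ^ (k + 1) = T (k + K) := by
      simp only [hT, pow_add]; ring
    have e2 : 4 * c * (1 / 2) ^ K * (1 / 2) ^ k = 4 * c * (1 / 2) ^ (k + K) := by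
      rw [pow_add]; ring
    have e3 : Λ (k + K) = L (4 * c * (1 / 2) ^ (k + K)) :=
      abs_of_nonneg (hL0 _ ⟨by positivity, (hK₁ _ (by omega)).1⟩)
    rw [e1, e2, ← e3]
    have e4 : (W (k + K) * Λ (k + K)) ^ p ≤
        h (φ (T (k + K))) ^ p * Λ (k + K) ^ p + (η (k + K) * Λ (k + K)) ^ p := by
      have hh0 := hh.nonneg (hφT0 (k + K))
      rw [← Real.mul_rpow hh0 (abs_nonneg _)]
      have p1 : 0 ≤ (h (φ (T (k + K))) * Λ (k + K)) ^ p :=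
        Real.rpow_nonneg (mul_nonneg hh0 (abs_nonneg _)) _
      have p2 : 0 ≤ (η (k + K) * Λ (k + K)) ^ p :=
        Real.rpow_nonneg (mul_nonneg (hη0 _).le (abs_nonneg _)) _
      rcases max_choice (h (φ (T (k + K)))) (η (k + K)) with hm | hm <;>
        simp only [hW, hm] <;> linarith
    calc N (k + K) * (W (k + K) * Λ (k + K)) ^ p
        ≤ N (k + K) * (h (φ (T (k + K))) ^ p * Λ (k + K) ^ p + (η (k + K) * Λ (k + K)) ^ p) :=
          mul_le_mul_of_nonneg_left e4 (hN0 _)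
      _ ≤ _ := by
          rw [mul_add]
          refine add_le_add (le_of_eq ?_) (hη _)
          simp only [hN]; ring
  -- the masses
  set a : X → ℝ := fun x => ∫ y in ball x (infDist x Ωᶜ / 4), α y ∂ν with ha
  have ha0 : ∀ x, 0 ≤ a x := setIntegral_ball_infDist_nonneg hα0
  have hasum : Summable fun x : SK => a x := by
    have := hS.summable_integral hCq hΩ hν hδ (hδ1.trans (by norm_num)) hα hα0
    exact this.comp_injective (i := fun x : SK => (⟨x, x.2.1⟩ : S)) fun x y hxy => by
      simpa [Subtype.ext_iff] using hxy
  obtain ⟨J, hJc, hJcov, hJsum⟩ := exists_countable_cover_of_not_summable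
    (fun x : SK => (x : X)) (fun x => 2 * φ (2 * c * infDist (x : X) Ωᶜ))
    (w := fun x => W (κ x)) (fun x => hW0 _) (fun x => ha0 x) hasum hε
  refine ⟨Subtype.val '' J, hJc.image _, ?_, ?_, ?_⟩
  · rintro _ ⟨x, -, rfl⟩
    exact x.2.2.trans (pow_le_pow_of_le_one (by norm_num) (by norm_num) hKn)
  · rintro ω ⟨hω, γ, hγ, hlim⟩
    by_contra hcon
    refine hlim ?_
    -- A point missed by the cover has a convergent sum of a/W over all shadows that contain it.
    have hnot : Summable ({x : SK | ω ∈ closedBall (x : X)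
        (2 * φ (2 * c * infDist (x : X) Ωᶜ))}.indicator fun x => a x / W (κ x)) := by
      by_contra hns
      obtain ⟨x, hxJ, hx⟩ := hJcov ω hns
      refine hcon (mem_iUnion.2 ⟨⟨x, x, hxJ, rfl⟩, ?_⟩)
      rwa [← mul_assoc, show (4 : ℝ) * 2 = 8 by norm_num] at hx
    set P : Set X := {x | ∃ t ∈ Ioc (0 : ℝ) 1, γ t ∈ ball x (δ * infDist x Ωᶜ)} with hP
    set P' : Set SK := Subtype.val ⁻¹' P with hP'
    have hshadow : P' ⊆ {x : SK | ω ∈ closedBall (x : X) (2 * φ (2 * c * infDist (x : X) Ωᶜ))} := by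
      rintro x ⟨t, ht, hxt⟩
      exact dist_le_of_mem_ball_of_mem_boundaryJohnCurves hφ hc hγ (hδ1.trans (by norm_num)) ht hxt
    have hsum1 : Summable (P'.indicator fun x => a x / W (κ x)) := by
      have := hnot.indicator P'
      rwa [indicator_indicator, inter_eq_left.2 hshadow] at this
    have hsum2 : Summable (P'.indicator fun x : SK => (W (κ x) * Λ (κ x)) ^ p) := by
      refine summable_indicator_of_card_fiber_le (fun x : SK => κ x)
        (g := fun k => (W k * Λ k) ^ p) (N := N)
        (fun k => Real.rpow_nonneg (mul_nonneg (hW0 _).le (abs_nonneg _)) _) ?_ hsumW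
      intro k F hF
      by_cases hk : K ≤ k
      · rw [← Finset.card_map (Function.Embedding.subtype _)]
        refine hS.card_le_of_mem_boundaryJohnCurves hq0.le hCq hΩ hν hδ (hδ1.trans (by norm_num))
          hφ hc hγ (r := (1 / 2) ^ k) (by positivity) (hK₁ k (hKK.trans hk)).2 ?_
        intro z hz
        obtain ⟨x, hx, rfl⟩ := Finset.mem_map.1 hz
        obtain ⟨hxP, rfl⟩ := hF x hx
        obtain ⟨h1, h2, -⟩ := hSKκ x x.2
        refine ⟨x.2.1, ?_, h2, hxP⟩
        rw [pow_succ] at h1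
        change _ ≤ infDist (x : X) Ωᶜ
        linarith
      · have : F = ∅ := by
          refine Finset.eq_empty_of_forall_notMem fun x hx => hk ?_
          rw [← (hF x hx).2]
          exact (hSKκ x x.2).2.2
        rw [this]
        simpa using hN0 k
    -- Hölder for a Λ = (a/W)(W Λ): the conjugate exponent turns (W Λ)^(1/q) into (W Λ)^p.
    have hconj : q.HolderConjugate (q / (q - 1)) := Real.HolderConjugate.conjExponent hq
    have hsum3 : Summable (P'.indicator fun x : SK => a x ^ (1 / q) * Λ (κ x) ^ (1 / q)) := by
      have := Real.summable_mul_of_Lp_Lq_of_nonneg hconj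
        (f := P'.indicator fun x => (a x / W (κ x)) ^ (1 / q))
        (g := P'.indicator fun x => (W (κ x) * Λ (κ x)) ^ (1 / q))
        (fun x => indicator_nonneg (fun x _ => Real.rpow_nonneg (div_nonneg (ha0 _) (hW0 _).le) _) x)
        (fun x => indicator_nonneg (fun x _ =>
          Real.rpow_nonneg (mul_nonneg (hW0 _).le (abs_nonneg _)) _) x) ?_ ?_
      · refine this.congr fun x => ?_
        by_cases hx : x ∈ P'
        · simp only [indicator_of_mem hx]
          rw [← Real.mul_rpow (ha0 _) (abs_nonneg _),
            ← Real.mul_rpow (div_nonneg (ha0 _) (hW0 _).le) (mul_nonneg (hW0 _).le (abs_nonneg _))]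
          congr 1
          have := (hW0 (κ x)).ne'
          field_simp
        · simp only [indicator_of_notMem hx, mul_zero]
      · refine hsum1.congr fun x => ?_
        by_cases hx : x ∈ P'
        · simp only [indicator_of_mem hx]
          rw [← Real.rpow_mul (div_nonneg (ha0 _) (hW0 _).le), one_div_mul_cancel hq0.ne',
            Real.rpow_one]
        · simp only [indicator_of_notMem hx, Real.zero_rpow hq0.ne']
      · refine hsum2.congr fun x => ?_
        by_cases hx : x ∈ P'
        · simp only [indicator_of_mem hx]
          rw [← Real.rpow_mul (mul_nonneg (hW0 _).le (abs_nonneg _))]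
          congr 1
          rw [hp]
          field_simp
        · simp only [indicator_of_notMem hx]
          rw [Real.zero_rpow (div_pos hq0 (by linarith)).ne']
    refine hS.exists_tendsto_of_summable hΩ hδ1 hω hγ.1 hγ.2.1 hγ.2.2.1
      (u := fun x => C * (a x ^ (1 / q) * Λ (κ x) ^ (1 / q))) (r₀ := (1 / 2) ^ K) (by positivity)
      (fun x => mul_nonneg hC (mul_nonneg (Real.rpow_nonneg (ha0 _) _)
        (Real.rpow_nonneg (abs_nonneg _) _))) ?_ ?_
    · intro x hxS hx
      obtain ⟨h1, h2, h3⟩ := hSKκ x ⟨hxS, hx⟩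
      refine (hf x (hS.subset hxS) (κ x) (hKk.trans h3) h1 h2).trans (le_of_eq ?_)
      have : Λ (κ x) = L (4 * c * (1 / 2) ^ κ x) :=
        abs_of_nonneg (hL0 _ ⟨by positivity, (hK₁ _ (hKK.trans h3)).1⟩)
      rw [this, mul_assoc]
    · have h1 : {x | x ∈ S ∧ infDist x Ωᶜ ≤ (1 / 2) ^ K ∧
          ∃ t ∈ Ioc (0 : ℝ) 1, γ t ∈ ball x (δ * infDist x Ωᶜ)} = SK ∩ P := by
        ext x
        simp only [hSK, hP, mem_ofPred_eq, mem_inter_iff, and_assoc]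
      rw [h1, ← indicator_indicator, ← summable_subtype_iff_indicator]
      refine (hsum3.mul_left C).congr fun x => ?_
      by_cases hx : (x : X) ∈ P
      · simp only [Function.comp_apply, indicator_of_mem hx, indicator_of_mem (show x ∈ P' from hx)]
      · simp only [Function.comp_apply, indicator_of_notMem hx,
          indicator_of_notMem (show x ∉ P' from hx), mul_zero]
  · rw [tsum_image (fun x : X => ENNReal.ofReal (h (φ (2 * c * infDist x Ωᶜ))))
      Subtype.val_injective.injOn]
    refine le_trans (ENNReal.tsum_le_tsum fun x => ENNReal.ofReal_le_ofReal ?_) hJsum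
    refine le_trans ?_ (le_max_left _ _)
    have h1 : 0 ≤ 2 * c * infDist (x : X) Ωᶜ := mul_nonneg (by positivity) infDist_nonneg
    have h2 : φ (2 * c * infDist (x : X) Ωᶜ) ≤ φ (T (κ x)) :=
      hφ.monotoneOn h1 (hT0 _).le
        (mul_le_mul_of_nonneg_left (hSKκ x x.1.2).2.1 (by positivity))
    exact hh.monotoneOn (hφ.nonneg h1) (hφT0 _) h2

/-- The common form of both parts of the theorem: `L` is the logarithmic factor of the class. -/
theorem hausdorffGauge_exceptionalSet_eq_zero (hq : 1 < q) (hCq : 1 ≤ Cq) (hc : 1 ≤ c)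
    (hφ : IsJohnFunction φ) (hΩ : IsBoundedProperDomain Ω) (hν : IsAhlforsRegular ν Ω q Cq)
    (hh : IsDoublingGauge h) (hL0 : ∀ t ∈ Ioo (0 : ℝ) 1, 0 ≤ L t) (hL : AntitoneOn L (Ioo 0 1))
    {α : X → ℝ} {C : ℝ} (hα : IntegrableOn α Ω ν) (hα0 : ∀ x ∈ Ω, 0 ≤ α x) (hC : 0 ≤ C)
    {δ : ℝ} (hδ : 0 < δ) (hδ1 : δ ≤ 1 / 4) {k₀ : ℕ}
    (hf : ∀ x ∈ Ω, ∀ k ≥ k₀, (1 / 2) ^ (k + 1) < infDist x Ωᶜ → infDist x Ωᶜ ≤ (1 / 2) ^ k →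
      ediam (f '' ball x (δ * infDist x Ωᶜ)) ≤ ENNReal.ofReal
        (C * (∫ y in ball x (infDist x Ωᶜ / 4), α y ∂ν) ^ (1 / q) *
          L (4 * c * (1 / 2) ^ k) ^ (1 / q)))
    (hint : IntegrableOn (fun t : ℝ => (φ t / t) ^ q * h (φ t) ^ (1 / (q - 1)) *
      L t ^ (1 / (q - 1)) * (1 / t)) (Ioo 0 1)) :
    hausdorffGauge h (exceptionalSet Ω φ c x₀ f) = 0 := by
  have hc0 : 0 < c := by linarith
  have hε : ∀ n : ℕ, (0 : ℝ) < 1 / ((n : ℝ) + 1) := fun n => Nat.one_div_pos_of_nat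
  choose J hJc hJd hJcov hJsum using fun n : ℕ => exists_countable_cover_exceptionalSet
    (x₀ := x₀) hq hCq hc hφ hΩ hν hh hL0 hL hα hα0 hC hδ hδ1 hf hint n (hε n)
  obtain ⟨D, hD0, hD⟩ := hh.exists_le_mul
  have : ∀ n, Countable (J n) := fun n => (hJc n).to_subtype
  have hφr : ∀ x : X, 0 ≤ φ (2 * c * infDist x Ωᶜ) := fun x =>
    hφ.nonneg (mul_nonneg (by positivity) infDist_nonneg)
  have hdiam : ∀ x : X, diam (closedBall x (8 * φ (2 * c * infDist x Ωᶜ))) ≤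
      16 * φ (2 * c * infDist x Ωᶜ) := fun x =>
    (diam_closedBall (mul_nonneg (by norm_num) (hφr x))).trans (by linarith)
  have hr : Tendsto (fun n : ℕ => ENNReal.ofReal (16 * φ (2 * c * (1 / 2 : ℝ) ^ n))) atTop
      (𝓝 0) := by
    have h0 : Tendsto (fun k : ℕ => (1 / 2 : ℝ) ^ k) atTop (𝓝 0) :=
      tendsto_pow_atTop_nhds_zero_of_lt_one (by norm_num) (by norm_num)
    have h1 : Tendsto (fun k : ℕ => 2 * c * (1 / 2 : ℝ) ^ k) atTop (𝓝[Ici 0] 0) := by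
      refine tendsto_nhdsWithin_iff.2 ⟨by simpa using h0.const_mul (2 * c), ?_⟩
      exact Eventually.of_forall fun k => mem_Ici.2 (by positivity)
    have h2 := ((hφ.continuousOn 0 (mem_Ici.2 le_rfl)).tendsto.comp h1).const_mul 16
    rw [hφ.map_zero, mul_zero] at h2
    simpa using ENNReal.tendsto_ofReal h2
  -- The n-th cover has weight sum at most 1/(n+1) and mesh at most 16 φ(2c 2^(-n)), which tends to
  -- 0; doubling of h pays for the factor 16.
  have key := Measure.mkMetric_le_liminf_tsum (exceptionalSet Ω φ c x₀ f) (l := atTop) _ hr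
    (fun n (x : J n) => closedBall (x : X) (8 * φ (2 * c * infDist (x : X) Ωᶜ)))
    (Eventually.of_forall fun n x => by
      rw [← ENNReal.ofReal_toReal (isBounded_closedBall (x := (x : X))
        (r := 8 * φ (2 * c * infDist (x : X) Ωᶜ))).ediam_ne_top]
      refine ENNReal.ofReal_le_ofReal ((hdiam x).trans ?_)
      gcongr
      exact hφ.monotoneOn (mem_Ici.2 (mul_nonneg (by positivity) infDist_nonneg))
        (mem_Ici.2 (by positivity)) (mul_le_mul_of_nonneg_left (hJd n x x.2) (by positivity)))
    (Eventually.of_forall hJcov) (fun d => ENNReal.ofReal (h d.toReal))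
  refine le_antisymm (key.trans (le_of_eq (Tendsto.liminf_eq ?_))) zero_le
  have hlim : Tendsto (fun n : ℕ => ENNReal.ofReal D * ENNReal.ofReal (1 / ((n : ℝ) + 1))) atTop
      (𝓝 0) := by
    have := ENNReal.Tendsto.const_mul (a := ENNReal.ofReal D)
      (ENNReal.tendsto_ofReal tendsto_one_div_add_atTop_nhds_zero_nat)
      (Or.inr ENNReal.ofReal_ne_top)
    simpa using this
  refine tendsto_of_tendsto_of_tendsto_of_le_of_le tendsto_const_nhds hlim
    (fun n => zero_le) fun n => ?_
  refine le_trans (ENNReal.tsum_le_tsum fun x => ?_)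
    (ENNReal.tsum_mul_left.le.trans (mul_le_mul_right (hJsum n) _))
  rw [← ENNReal.ofReal_mul hD0]
  refine ENNReal.ofReal_le_ofReal (le_trans ?_ (hD _ (hφr x)))
  exact hh.monotoneOn (mem_Ici.2 diam_nonneg) (mem_Ici.2 (mul_nonneg (by norm_num) (hφr x)))
    (hdiam x)

/-- The first part of the theorem, which holds for every dilation factor `σ ≥ 1`. -/
theorem ClassA₁.hausdorffGauge_exceptionalSet_eq_zero [CompleteSpace X] {σ : ℝ} (hσ : 1 ≤ σ)
    (hq : 1 < q)     (hCq : 1 ≤ Cq) (hc : 1 ≤ c) (hφ : IsJohnFunction φ)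
    (hΩ : IsBoundedProperDomain Ω) (hν : IsAhlforsRegular ν Ω q Cq) (hh : IsDoublingGauge h) (hf : ClassA₁ ν Ω q σ f)
    (hint : IntegrableOn (fun t : ℝ => (φ t / t) ^ q * h (φ t) ^ (1 / (q - 1)) * (1 / t))
      (Ioo 0 1)) :
    hausdorffGauge h (exceptionalSet Ω φ c x₀ f) = 0 := by
  obtain ⟨α, C, hα, hα0, hC, hball⟩ := hf
  have hσ0 : 0 < σ := by linarith
  -- With δ = 1/(4σ) the dilate σB of a Whitney ball is B(x, d(x)/4), whatever σ is.
  refine LengthJohn.hausdorffGauge_exceptionalSet_eq_zero (L := fun _ => 1) (C := C)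
    (δ := 1 / (4 * σ)) (k₀ := 0) hq hCq hc hφ hΩ hν hh (fun _ _ => zero_le_one)
    (fun _ _ _ _ _ => le_rfl) hα hα0 (by linarith) (by positivity)
    (one_div_le_one_div_of_le (by norm_num) (by linarith)) ?_ (by simpa using hint)
  intro x hx k _ _ _
  have hd := infDist_compl_pos hΩ hx
  have hr : σ * (1 / (4 * σ) * infDist x Ωᶜ) = infDist x Ωᶜ / 4 := by field_simp
  have := hball x (1 / (4 * σ) * infDist x Ωᶜ) (by positivity)
    (by rw [hr]; exact compactlyContained_ball hCq hΩ hν hx)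
  rw [hr] at this
  simpa using this

/-- The second part of the theorem, which holds for every dilation factor `σ ≥ 1`. -/
theorem ClassA₂.hausdorffGauge_exceptionalSet_eq_zero [CompleteSpace X] {σ : ℝ} (hσ : 1 ≤ σ)
    (hq : 1 < q)     (hCq : 1 ≤ Cq) (hc : 1 ≤ c) (hφ : IsJohnFunction φ)
    (hΩ : IsBoundedProperDomain Ω) (hν : IsAhlforsRegular ν Ω q Cq) (hh : IsDoublingGauge h) (hf : ClassA₂ ν Ω q σ f)
    (hint : IntegrableOn (fun t : ℝ => (φ t / t) ^ q * h (φ t) ^ (1 / (q - 1)) *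
      Real.log (1 / t) ^ (1 / (q - 1)) * (1 / t)) (Ioo 0 1)) :
    hausdorffGauge h (exceptionalSet Ω φ c x₀ f) = 0 := by
  obtain ⟨α, C, hα, hα0, hC, hball⟩ := hf
  have hσ0 : 0 < σ := by linarith
  have hc0 : 0 < c := by linarith
  have hq0 : 0 < q := by linarith
  set δ := 1 / (4 * σ) with hδ
  have hδ0 : 0 < δ := by positivity
  have hδ1 : δ ≤ 1 / 4 := one_div_le_one_div_of_le (by norm_num) (by linarith)
  -- For u = 2^(-k) ≤ δ/(32c²) one has (4cu)² ≤ δu/2 ≤ diam B, hence log(1/diam B) ≤ 2 log(1/(4cu));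
  -- the 2 is absorbed into the constant.
  obtain ⟨k₀, hk₀⟩ := exists_pow_lt_of_lt_one (show 0 < δ / (32 * c ^ 2) by positivity)
    (show (1 / 2 : ℝ) < 1 by norm_num)
  refine LengthJohn.hausdorffGauge_exceptionalSet_eq_zero (L := fun t => Real.log (1 / t))
    (C := C * 2 ^ (1 / q)) (δ := δ) (k₀ := k₀) hq hCq hc hφ hΩ hν hh ?_ ?_ hα hα0 (by positivity)
    hδ0 hδ1 ?_ hint
  · exact fun t ht => Real.log_nonneg ((one_le_div ht.1).2 ht.2.le)
  · intro s hs t ht hst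
    exact Real.log_le_log (one_div_pos.2 ht.1) (one_div_le_one_div_of_le hs.1 hst)
  · intro x hx k hk hk1 hk2
    have hd := infDist_compl_pos hΩ hx
    have hr : σ * (δ * infDist x Ωᶜ) = infDist x Ωᶜ / 4 := by rw [hδ]; field_simp
    have hone : (1 / 2 : ℝ) ^ k ≤ 1 := pow_le_one₀ (by norm_num) (by norm_num)
    have hrd : δ * infDist x Ωᶜ ≤ infDist x Ωᶜ / 4 := by nlinarith
    have hd1 : diam (ball x (δ * infDist x Ωᶜ)) < 1 :=
      (diam_ball (by positivity)).trans_lt (by linarith)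
    have hd2 : δ * infDist x Ωᶜ ≤ diam (ball x (δ * infDist x Ωᶜ)) :=
      le_diam_ball_of_le_infDist_compl (nonempty_compl.2 hΩ.ne_univ) (by positivity) (by linarith)
    have hd0 : 0 < diam (ball x (δ * infDist x Ωᶜ)) := lt_of_lt_of_le (by positivity) hd2
    have hmain := hball x (δ * infDist x Ωᶜ) (by positivity)
      (by rw [hr]; exact compactlyContained_ball hCq hΩ hν hx) hd1
    rw [hr] at hmain
    refine hmain.trans (ENNReal.ofReal_le_ofReal ?_)
    have hI := setIntegral_ball_infDist_nonneg (ν := ν) hα0 x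
    set u : ℝ := (1 / 2) ^ k with hu
    have hu0 : 0 < u := by positivity
    have hlog : Real.log (1 / diam (ball x (δ * infDist x Ωᶜ))) ≤
        2 * Real.log (1 / (4 * c * u)) := by
      rw [show (2 : ℝ) * Real.log (1 / (4 * c * u)) = Real.log ((1 / (4 * c * u)) ^ 2) by
        rw [Real.log_pow]; norm_num]
      refine Real.log_le_log (one_div_pos.2 hd0) ?_
      rw [div_pow, one_pow]
      refine one_div_le_one_div_of_le (by positivity) (le_trans ?_ hd2)
      have h1 : u ≤ δ / (32 * c ^ 2) :=
        (pow_le_pow_of_le_one (by norm_num) (by norm_num) hk).trans hk₀.le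
      rw [le_div_iff₀ (by positivity)] at h1
      rw [pow_succ] at hk1
      have h2 : u * (u * (32 * c ^ 2)) ≤ u * δ := by gcongr
      have h3 : δ * (u * (1 / 2)) ≤ δ * infDist x Ωᶜ := by gcongr
      linarith
    have hlog0 : 0 ≤ Real.log (1 / diam (ball x (δ * infDist x Ωᶜ))) :=
      Real.log_nonneg ((one_le_div hd0).2 hd1.le)
    have hpow : Real.log (1 / diam (ball x (δ * infDist x Ωᶜ))) ^ (1 / q) ≤
        2 ^ (1 / q) * Real.log (1 / (4 * c * u)) ^ (1 / q) := by
      rw [← Real.mul_rpow (by norm_num) (by linarith)]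
      exact Real.rpow_le_rpow hlog0 hlog (by positivity)
    calc _ ≤ C * (∫ y in ball x (infDist x Ωᶜ / 4), α y ∂ν) ^ (1 / q) *
          (2 ^ (1 / q) * Real.log (1 / (4 * c * u)) ^ (1 / q)) := by gcongr
      _ = _ := by ring

end Main

end LengthJohn

theorem theorem1p3 (q Cq c : ℝ) (hq : 1 < q) (hCq : 1 ≤ Cq) (hc : 1 ≤ c)
    (φ : ℝ → ℝ) (hφ : LengthJohn.IsJohnFunction φ) :
    ∃ σ : ℝ, 1 ≤ σ ∧
      ∀ (X₁ : Type u) [MetricSpace X₁] [CompleteSpace X₁] [PathConnectedSpace X₁]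
        [MeasurableSpace X₁] [BorelSpace X₁] (ν₁ : Measure X₁)
        (X₂ : Type v) [MetricSpace X₂] [CompleteSpace X₂] [PathConnectedSpace X₂]
        (Ω : Set X₁) (x₀ : X₁),
        LengthJohn.IsBoundedProperDomain Ω →
        LengthJohn.IsAhlforsRegular ν₁ Ω q Cq →
        LengthJohn.IsLengthJohnDomain Ω φ c x₀ →
        ∀ (f : X₁ → X₂) (h : ℝ → ℝ), LengthJohn.IsDoublingGauge h →
          (LengthJohn.ClassA₁ ν₁ Ω q σ f →
            IntegrableOn
              (fun t : ℝ => (φ t / t) ^ q * h (φ t) ^ (1 / (q - 1)) * (1 / t)) (Ioo 0 1) →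
            LengthJohn.hausdorffGauge h (LengthJohn.exceptionalSet Ω φ c x₀ f) = 0) ∧
          (LengthJohn.ClassA₂ ν₁ Ω q σ f →
            IntegrableOn
              (fun t : ℝ => (φ t / t) ^ q * h (φ t) ^ (1 / (q - 1)) *
                Real.log (1 / t) ^ (1 / (q - 1)) * (1 / t)) (Ioo 0 1) →
            LengthJohn.hausdorffGauge h (LengthJohn.exceptionalSet Ω φ c x₀ f) = 0) := by
  -- Any σ ≥ 1 would do, since the Whitney parameter δ adapts to it.
  refine ⟨1, le_rfl, ?_⟩
  intro X₁ _ _ _ _ _ ν₁ X₂ _ _ _ Ω x₀ hΩ hν _ f h hh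
  exact ⟨fun hf hint => hf.hausdorffGauge_exceptionalSet_eq_zero le_rfl hq hCq hc hφ hΩ hν hh hint,
    fun hf hint => hf.hausdorffGauge_exceptionalSet_eq_zero le_rfl hq hCq hc hφ hΩ hν hh hint⟩
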